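/- Let $n\ge 1$ and let $\mathbb{H}^n=\mathbb{C}^n\times\mathbb{R}$ be the Heisenberg group with product $[z,t]*[z',t']=[z+z',\,t+t'+\mathrm{Im}\sum_{i}z_i\overline{z}'_i]$ and with the left-invariant Riemannian metric $\langle\cdot,\cdot\rangle$ for which $X_k=\partial_{x_k}+y_k\partial_t$, $Y_k=\partial_{y_k}-x_k\partial_t$ $(1\le k\le n)$ and $T=\partial_t$ are orthonormal; let $D$ be its Levi-Civita connection. A vector is horizontal if it is a combination of the $X_k,Y_k$, and $U_H$ denotes the horizontal projection of $U$. For an embedded $C^2$ hypersurface $\Sigma\subset\mathbb{H}^n$ the singular set $\Sigma_0$ consists of the points of $\Sigma$ at which the tangent hyperplane is the horizontal hyperplane. If $N$ is a continuous unit normal field on $\Sigma$, put $\nu_H=N_H/|N_H|$ on $\Sigma\setminus\Sigma_0$; the mean curvature $h$ of $\Sigma$ with respect to $N$ is defined on $\Sigma\setminus\Sigma_0$ by $-2n\,h=\mathrm{div}_\Sigma\,\nu_H=\sum_{i=1}^{2n}\langle D_{e_i}\nu_H,e_i\rangle$, where $(e_i)$ is any orthonormal basis of the tangent space. $\Sigma$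 has constant mean curvature $h\in\mathbb{R}$ if, for some continuous unit normal field, its mean curvature equals $h$ at every point of $\Sigma\setminus\Sigma_0$. $\Sigma$ is rotationally invariant if it is invariant under all rotations of $\mathbb{R}^{2n+1}$ about the $t$-axis, i.e. under the maps $[z,t]\mapsto[Az,t]$ with $A\in SO(2n)$ acting on $\mathbb{C}^n=\mathbb{R}^{2n}$. For $H>0$ let $$S_H=\Big\{[z,t] : |z|\le \tfrac1H,\ t=\pm\tfrac{1}{2H^2}\big(H|z|\sqrt{1-H^2|z|^2}+\arccos(H|z|)\big)\Big\}.$$ Then, up to translation along the $t$-axis, the only compact, connected, embedded, rotationally invariant $C^2$ hypersurfaces of constant mean curvature in $\mathbb{H}^n$ are the spheres $S_H$, $H>0$. Precisely: (1) for every $H>0$ and $t_0\in\mathbb{R}$ the translate $[0,t_0]*S_H$ is a compact, connected, embedded, rotationally invariant $C^2$ hypersurface of constant mean curvature $H$; (2) if $\Sigma$ is a compact, connected, embedded, rotationally invariant $C^2$ hypersurface of constant mean curvature $h$ in $\mathbb{H}^n$, then $h\ne 0$ and $\Sigma=[0,t_0]*S_{|h|}$ for some $t_0\in\mathbb{R}$.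 -/

import Mathlib

open scoped ComplexConjugate Topology ContDiff

noncomputable section

/-- The underlying space `ℂⁿ × ℝ` of the `n`-dimensional Heisenberg group; a point is `[z, t]`.
It carries its usual topology and differentiable structure, and tangent vectors at any point
are written in the coordinates of `ℂⁿ × ℝ` as well. -/
abbrev Heis (n : ℕ) : Type := EuclideanSpace ℂ (Fin n) × ℝ

namespace Heis

variable {n : ℕ}

/-- `Im (∑ₖ zₖ w̄ₖ)`. -/
def imPair (z w : EuclideanSpace ℂ (Fin n)) : ℝ := (∑ k, z k * conj (w k)).im

/-- The group product `[z, t] * [z', t'] = [z + z', t + t' + Im ∑ zₖ z̄'ₖ]`, so that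
`hmul p` is the left translation by `p`. -/
def hmul (p q : Heis n) : Heis n := (p.1 + q.1, p.2 + q.2 + imPair p.1 q.1)

/-- The left-invariant vector field `X_k = ∂/∂x_k + y_k ∂/∂t`. -/
def X (k : Fin n) (p : Heis n) : Heis n := (EuclideanSpace.single k 1, (p.1 k).im)

/-- The left-invariant vector field `Y_k = ∂/∂y_k - x_k ∂/∂t`. -/
def Y (k : Fin n) (p : Heis n) : Heis n := (EuclideanSpace.single k Complex.I, -(p.1 k).re)

/-- The left-invariant vector field `T = ∂/∂t`. -/
def T (_p : Heis n) : Heis n := (0, 1)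

/-- The tangent vector `∑ₖ (Re aₖ) X_k + (Im aₖ) Y_k + c T` at `p`. -/
def ofFrame (p : Heis n) (a : EuclideanSpace ℂ (Fin n)) (c : ℝ) : Heis n :=
  (∑ k, ((a k).re • X k p + (a k).im • Y k p)) + c • T p

/-- The `T`-coefficient of a tangent vector `u` at `p` in the frame `X_k, Y_k, T`
(the `X_k` and `Y_k` coefficients are the real and imaginary parts of `u.1 k`). -/
def theta (p u : Heis n) : ℝ := u.2 - imPair p.1 u.1

/-- The left-invariant Riemannian metric for which `X_k, Y_k, T` is an orthonormal basis at
every point `p`. -/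
def metric (p u v : Heis n) : ℝ :=
  (∑ k, ((u.1 k).re * (v.1 k).re + (u.1 k).im * (v.1 k).im)) + theta p u * theta p v

/-- The horizontal hyperplane at `p`, spanned by the `X_k` and `Y_k`. -/
def horizontal (p : Heis n) : Set (Heis n) :=
  Submodule.span ℝ (Set.range (fun k => X k p) ∪ Set.range (fun k => Y k p))

/-- The horizontal projection `u_H` of a tangent vector `u` at `p`. -/
def hproj (p u : Heis n) : Heis n := u - theta p u • T p

/-- The Levi-Civita connection `D_u V` at `p` of the metric, in the frame `X_k, Y_k, T`.
If `V` has frame coefficients `(f, h)` and `u` has frame coefficients `(a, c)`, with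
`f, a` in `ℂⁿ`, then `D_u V` has frame coefficients
`(u(f) + i (c f + h a), u(h) - Im ∑ₖ fₖ āₖ)`. This encodes
`D_{X_k} Y_j = -δ T`, `D_{Y_k} X_j = δ T`, `D_{X_k} T = D_T X_k = Y_k`,
`D_{Y_k} T = D_T Y_k = -X_k`, the other derivatives of frame fields being zero. -/
def covDeriv (V : Heis n → Heis n) (p u : Heis n) : Heis n :=
  ofFrame p
    (fderiv ℝ (fun q => (V q).1) p u
      + Complex.I • (theta p u • (V p).1 + theta p (V p) • u.1))
    (fderiv ℝ (fun q => theta q (V q)) p u - imPair (V p).1 u.1)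

/-- `S` is an embedded hypersurface of class `C²`: near each of its points it is the zero set
of a `C²` function with non-vanishing differential. -/
def IsC2Hypersurface (S : Set (Heis n)) : Prop :=
  ∀ p ∈ S, ∃ U : Set (Heis n), IsOpen U ∧ p ∈ U ∧ ∃ f : Heis n → ℝ,
    ContDiffOn ℝ 2 f U ∧ (∀ q ∈ S ∩ U, fderiv ℝ f q ≠ 0) ∧ S ∩ U = {q ∈ U | f q = 0}

/-- The tangent space of `S` at `p`: the velocities at `p` of curves in `S`. -/
def tangent (S : Set (Heis n)) (p : Heis n) : Set (Heis n) :=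
  {u | ∃ c : ℝ → Heis n, c 0 = p ∧ (∀ᶠ s in 𝓝 (0 : ℝ), c s ∈ S) ∧ HasDerivAt c u 0}

/-- The singular set: the points where the tangent hyperplane is the horizontal hyperplane. -/
def singularSet (S : Set (Heis n)) : Set (Heis n) :=
  {p ∈ S | tangent S p = horizontal p}

/-- `N` restricts to a (continuous) unit normal vector field on `S`. -/
def IsUnitNormal (S : Set (Heis n)) (N : Heis n → Heis n) : Prop :=
  ContinuousOn N S ∧
    ∀ p ∈ S, metric p (N p) (N p) = 1 ∧ ∀ u ∈ tangent S p, metric p (N p) u = 0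

/-- The horizontal unit normal `ν_H = N_H / |N_H|`. -/
def horizontalNormal (N : Heis n → Heis n) (p : Heis n) : Heis n :=
  (Real.sqrt (metric p (hproj p (N p)) (hproj p (N p))))⁻¹ • hproj p (N p)

/-- `d` is the divergence relative to `S` at `p` of the vector field `U` along `S`, that is
`d = ∑ᵢ ⟨D_{eᵢ} U, eᵢ⟩` for an orthonormal basis `e` of the tangent space of `S` at `p`.
Derivatives in tangent directions are computed with a local extension `V` of `U`, differentiable
at `p`; neither the extension nor the basis affects the value. -/
def HasDivAlong (S : Set (Heis n)) (U : Heis n → Heis n) (p : Heis n) (d : ℝ) : Prop :=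
  ∃ V : Heis n → Heis n, DifferentiableAt ℝ V p ∧ (∀ᶠ q in 𝓝[S] p, V q = U q) ∧
    ∃ e : Fin (2 * n) → Heis n, (∀ i, e i ∈ tangent S p) ∧
      (∀ i j, metric p (e i) (e j) = if i = j then 1 else 0) ∧
      d = ∑ i, metric p (covDeriv V p (e i)) (e i)

/-- `S` has constant mean curvature `h` with respect to some unit normal field `N`:
`-2n h = div_S ν_H` at every regular point. -/
def HasConstantMeanCurvature (S : Set (Heis n)) (h : ℝ) : Prop :=
  ∃ N : Heis n → Heis n, IsUnitNormal S N ∧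
    ∀ p ∈ S \ singularSet S, HasDivAlong S (horizontalNormal N) p (-2 * n * h)

/-- `S` is invariant under all rotations of `ℝ²ⁿ⁺¹` about the `t`-axis, i.e. under `SO(2n)`
acting on the factor `ℂⁿ = ℝ²ⁿ`. -/
def IsRotationallyInvariant (S : Set (Heis n)) : Prop :=
  ∀ A : EuclideanSpace ℂ (Fin n) ≃ₗᵢ[ℝ] EuclideanSpace ℂ (Fin n),
    LinearMap.det (A.toLinearEquiv : EuclideanSpace ℂ (Fin n) →ₗ[ℝ] EuclideanSpace ℂ (Fin n)) = 1 →
      (fun p : Heis n => ((A p.1, p.2) : Heis n)) '' S = S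

/-- The spherical hypersurface `S_H`, given by
`t = ± (1 / (2H²)) (H|z| √(1 - H²|z|²) + arccos (H|z|))`, `|z| ≤ 1/H`. -/
def sphere (n : ℕ) (H : ℝ) : Set (Heis n) :=
  {p | ‖p.1‖ ≤ 1 / H ∧
    (p.2 = 1 / (2 * H ^ 2) *
        (H * ‖p.1‖ * Real.sqrt (1 - H ^ 2 * ‖p.1‖ ^ 2) + Real.arccos (H * ‖p.1‖)) ∨
     p.2 = -(1 / (2 * H ^ 2) *
        (H * ‖p.1‖ * Real.sqrt (1 - H ^ 2 * ‖p.1‖ ^ 2) + Real.arccos (H * ‖p.1‖))))}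

/-! The frame is orthonormal, and `covDeriv` is compatible with the metric and torsion-free,
so it is the Levi-Civita connection. -/

theorem ofFrame_eq (p : Heis n) (a : EuclideanSpace ℂ (Fin n)) (c : ℝ) :
    ofFrame p a c = (a, c + imPair p.1 a) := by
  refine Prod.ext ?_ ?_
  · ext j
    have h : ∀ k : Fin n, (a k).re • (X k p).1 j + (a k).im • (Y k p).1 j
        = if j = k then a k else 0 := by
      intro k
      by_cases hk : j = k
      · subst hk
        simp [X, Y]
      · simp [X, Y, hk]
    simp only [ofFrame, T, Prod.fst_add, Prod.fst_sum, Prod.smul_fst, smul_zero, add_zero,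
      WithLp.ofLp_sum, WithLp.ofLp_add, WithLp.ofLp_smul, Finset.sum_apply, Pi.add_apply,
      Pi.smul_apply, h]
    simp
  · simp only [ofFrame, T, Prod.snd_add, Prod.snd_sum, Prod.smul_snd, X, Y, imPair,
      Complex.im_sum, Complex.mul_im, Complex.conj_re, Complex.conj_im, smul_eq_mul, mul_one]
    rw [add_comm]
    congr 1
    exact Finset.sum_congr rfl fun k _ => by ring

theorem theta_ofFrame (p : Heis n) (a : EuclideanSpace ℂ (Fin n)) (c : ℝ) :
    theta p (ofFrame p a c) = c := by
  simp [theta, ofFrame_eq]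

theorem metric_ofFrame (p : Heis n) (a b : EuclideanSpace ℂ (Fin n)) (c d : ℝ) :
    metric p (ofFrame p a c) (ofFrame p b d)
      = (∑ k, ((a k).re * (b k).re + (a k).im * (b k).im)) + c * d := by
  simp only [metric, theta_ofFrame]
  simp [ofFrame_eq]

theorem hasFDerivAt_re {f : Heis n → EuclideanSpace ℂ (Fin n)} {p : Heis n}
    (hf : DifferentiableAt ℝ f p) (k : Fin n) :
    HasFDerivAt (fun q => (f q k).re) ((Complex.reCLM.comp
      ((EuclideanSpace.proj k : EuclideanSpace ℂ (Fin n) →L[ℂ] ℂ).restrictScalars ℝ)).comp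
        (fderiv ℝ f p)) p :=
  (Complex.reCLM.comp ((EuclideanSpace.proj k : EuclideanSpace ℂ (Fin n) →L[ℂ] ℂ).restrictScalars
    ℝ)).hasFDerivAt.comp p hf.hasFDerivAt

theorem hasFDerivAt_im {f : Heis n → EuclideanSpace ℂ (Fin n)} {p : Heis n}
    (hf : DifferentiableAt ℝ f p) (k : Fin n) :
    HasFDerivAt (fun q => (f q k).im) ((Complex.imCLM.comp
      ((EuclideanSpace.proj k : EuclideanSpace ℂ (Fin n) →L[ℂ] ℂ).restrictScalars ℝ)).comp
        (fderiv ℝ f p)) p :=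
  (Complex.imCLM.comp ((EuclideanSpace.proj k : EuclideanSpace ℂ (Fin n) →L[ℂ] ℂ).restrictScalars
    ℝ)).hasFDerivAt.comp p hf.hasFDerivAt

theorem imPair_eq (z w : EuclideanSpace ℂ (Fin n)) :
    imPair z w = ∑ k, ((z k).im * (w k).re - (z k).re * (w k).im) := by
  simp only [imPair, Complex.im_sum, Complex.mul_im, Complex.conj_re, Complex.conj_im]
  exact Finset.sum_congr rfl fun k _ => by ring

theorem fderiv_imPair {f g : Heis n → EuclideanSpace ℂ (Fin n)} {p : Heis n}
    (hf : DifferentiableAt ℝ f p) (hg : DifferentiableAt ℝ g p) :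
    DifferentiableAt ℝ (fun q => imPair (f q) (g q)) p ∧
    ∀ u, fderiv ℝ (fun q => imPair (f q) (g q)) p u
      = imPair (fderiv ℝ f p u) (g p) + imPair (f p) (fderiv ℝ g p u) := by
  have h := HasFDerivAt.fun_sum (u := Finset.univ) fun k _ =>
    ((hasFDerivAt_im hf k).mul (hasFDerivAt_re hg k)).sub
      ((hasFDerivAt_re hf k).mul (hasFDerivAt_im hg k))
  have h2 := h.congr_of_eventuallyEq (f₁ := fun q => imPair (f q) (g q))
    (Filter.Eventually.of_forall fun q => imPair_eq _ _)
  refine ⟨h2.differentiableAt, fun u => ?_⟩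
  rw [h2.fderiv, imPair_eq, imPair_eq, ← Finset.sum_add_distrib]
  simp only [_root_.sum_apply]
  refine Finset.sum_congr rfl fun k _ => ?_
  simp
  ring

theorem imPair_anti (z w : EuclideanSpace ℂ (Fin n)) : imPair z w = -imPair w z := by
  rw [imPair_eq, imPair_eq, ← Finset.sum_neg_distrib]
  exact Finset.sum_congr rfl fun k _ => by ring

theorem fderiv_theta {V : Heis n → Heis n} {p : Heis n} (hV : DifferentiableAt ℝ V p) :
    DifferentiableAt ℝ (fun q => theta q (V q)) p ∧
    ∀ u, fderiv ℝ (fun q => theta q (V q)) p u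
      = (fderiv ℝ V p u).2 - (imPair u.1 (V p).1 + imPair p.1 (fderiv ℝ V p u).1) := by
  obtain ⟨h1, h2⟩ := fderiv_imPair (differentiableAt_fst (𝕜 := ℝ) (p := p)) hV.fst
  refine ⟨hV.snd.sub h1, fun u => ?_⟩
  simp only [theta]
  rw [fderiv_fun_sub hV.snd h1, _root_.sub_apply, h2, fderiv.snd hV, fderiv.fst hV,
    fderiv_fst]
  simp

theorem covDeriv_metric {U V : Heis n → Heis n} {p : Heis n}
    (hU : DifferentiableAt ℝ U p) (hV : DifferentiableAt ℝ V p) (u : Heis n) :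
    fderiv ℝ (fun q => metric q (U q) (V q)) p u
      = metric p (covDeriv U p u) (V p) + metric p (U p) (covDeriv V p u) := by
  have h := (HasFDerivAt.fun_sum (u := Finset.univ) fun k _ =>
    ((hasFDerivAt_re hU.fst k).mul (hasFDerivAt_re hV.fst k)).add
      ((hasFDerivAt_im hU.fst k).mul (hasFDerivAt_im hV.fst k))).add
    ((fderiv_theta hU).1.hasFDerivAt.mul (fderiv_theta hV).1.hasFDerivAt)
  have h2 := h.congr_of_eventuallyEq (f₁ := fun q => metric q (U q) (V q))
    (Filter.Eventually.of_forall fun q => rfl)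
  rw [h2.fderiv]
  simp only [metric, covDeriv, theta_ofFrame]
  have key : ∀ (w f a g : EuclideanSpace ℂ (Fin n)) (c d : ℝ),
      ∑ k, (((w + Complex.I • (c • f + d • a)) k).re * (g k).re
        + ((w + Complex.I • (c • f + d • a)) k).im * (g k).im)
      = ∑ k, ((w k).re * (g k).re + (w k).im * (g k).im) - c * imPair f g - d * imPair a g := by
    intro w f a g c d
    rw [imPair_eq, imPair_eq, Finset.mul_sum, Finset.mul_sum, ← Finset.sum_sub_distrib,
      ← Finset.sum_sub_distrib]
    refine Finset.sum_congr rfl fun k _ => ?_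
    simp
    ring
  have comm : ∀ z w : EuclideanSpace ℂ (Fin n),
      ∑ k, ((z k).re * (w k).re + (z k).im * (w k).im)
        = ∑ k, ((w k).re * (z k).re + (w k).im * (z k).im) := fun z w =>
    Finset.sum_congr rfl fun k _ => by ring
  simp only [ofFrame_eq]
  rw [comm (U p).1, key, key, comm _ (U p).1, imPair_anti (V p).1 (U p).1, imPair_anti u.1 (U p).1, imPair_anti u.1 (V p).1]
  have hs : ∑ k, (((U p).1 k).re * ((fderiv ℝ (fun q => (V q).1) p u) k).re
        + ((U p).1 k).im * ((fderiv ℝ (fun q => (V q).1) p u) k).im)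
      + ∑ k, (((fderiv ℝ (fun q => (U q).1) p u) k).re * ((V p).1 k).re
        + ((fderiv ℝ (fun q => (U q).1) p u) k).im * ((V p).1 k).im)
      = ∑ k, (((U p).1 k).re * ((fderiv ℝ (fun q => (V q).1) p u) k).re
        + ((V p).1 k).re * ((fderiv ℝ (fun q => (U q).1) p u) k).re
        + (((U p).1 k).im * ((fderiv ℝ (fun q => (V q).1) p u) k).im
        + ((V p).1 k).im * ((fderiv ℝ (fun q => (U q).1) p u) k).im)) := by
    rw [← Finset.sum_add_distrib]
    exact Finset.sum_congr rfl fun k _ => by ring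
  simp only [_root_.add_apply, _root_.sum_apply, _root_.smul_apply,
    ContinuousLinearMap.comp_apply, ContinuousLinearMap.coe_restrictScalars', smul_eq_mul,
    Complex.reCLM_apply, Complex.imCLM_apply, PiLp.proj_apply]
  linarith [hs]

theorem covDeriv_torsion {U V : Heis n → Heis n} {p : Heis n}
    (hU : DifferentiableAt ℝ U p) (hV : DifferentiableAt ℝ V p) :
    covDeriv V p (U p) - covDeriv U p (V p) = VectorField.lieBracket ℝ U V p := by
  refine Prod.ext ?_ ?_
  · simp only [covDeriv, ofFrame_eq, VectorField.lieBracket, fderiv.fst hU, fderiv.fst hV]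
    simp
    abel
  · have h1 := (fderiv_theta hU).2 (V p)
    have h2 := (fderiv_theta hV).2 (U p)
    simp only [covDeriv, ofFrame_eq, VectorField.lieBracket, fderiv.fst hU, fderiv.fst hV, h1, h2]
    have hadd : ∀ z a b : EuclideanSpace ℂ (Fin n),
        imPair z (a + b) = imPair z a + imPair z b := by
      intro z a b
      rw [imPair_eq, imPair_eq, imPair_eq, ← Finset.sum_add_distrib]
      refine Finset.sum_congr rfl fun k _ => ?_
      simp
      ring
    simp only [Prod.snd_sub, hadd, ContinuousLinearMap.comp_apply, ContinuousLinearMap.coe_fst',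
      imPair_anti (V p).1 (U p).1, add_comm (theta p (V p) • (U p).1)]
    ring

end Heis

end

/-!
A rotationally invariant hypersurface is determined by its profile, the curve of the points
`(r, t) = (|z|, t)`. Away from the axis the horizontal normal is `ν_H = ((c + i s) / r) z` in frame
coordinates, with `c = cos ψ` and `s = sin ψ` functions of `(r, t)`, and the profile is an integral
curve of `r' = s`, `t' = r c`. The divergence of `ν_H` works out to `(2n - 1) c / r - ψ'`
(`hasDivAlong_iff`), so mean curvature `h` amounts to the ordinary differential equation
`ψ' = (2n - 1) c / r + 2n h` (`angle_deriv`).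

Uniqueness. The function `2n h t - r s` has derivative `-(s² + (2n - 1) c²) < 0` along the profile,
so on a compact hypersurface its maximum and its minimum are attained on the axis, at which it
equals `2n h t`. Since a hypersurface is not contained in the axis, these two values differ; hence
`h ≠ 0` and the hypersurface meets the axis at two heights at least. The quantity
`r ^ (2n - 1) c + h r ^ (2n)` is constant along the profile, and it vanishes on the axis, so that
`c = -h r` everywhere (`IsRotationalCMC.firstIntegral_eq`). The remaining equation is integrated by
`t - (arcsin s + s |h| r) / (2 h |h|)`, again a constant (`IsRotationalCMC.arc_position_eq`), and
this says that the hypersurface lies in a sphere `S_|h|`. By connectedness its heights fill the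
interval between the two poles, and rotations act transitively on the points of given `r` and `t`,
so it is the whole sphere (`IsRotationalCMC.eq_sphere`).

No parametrization of the profile is used: a function whose differential kills the tangent
directions is locally constant on a level set (`ContDiffAt.eventually_eq_of_ker_fderiv_le`). The
hypersurface minus the axis need not be known to be connected either: a continuous function on a
connected set which is locally constant off a countable set has countable image, hence is constant
(`IsPreconnected.eq_of_locallyConst_off_countable`), and the points on the axis are isolated in the
axis because the tangent space there is horizontal (`axis_point`, `countable_axis`).

Existence. With `H r = cos φ` and `2 H² (t - t₀) = φ + sin φ cos φ` for `|φ| ≤ π / 2`, the sphere is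
the zero set of `cos φ - H r`, where `φ` is regarded as a function of `t` by inverting
`φ + sin φ cos φ`. This describes it off the poles, with `c = -cos φ` and `s = sin φ`. Near a pole
it is the graph of a function of `|z|` whose gradient is a smooth multiple of `|z| z`; as
`z ↦ |z| z` is of class `C¹` (`contDiff_norm_smul_self`), the sphere is of class `C²` there.
-/

noncomputable section

namespace Heis

variable {n : ℕ}

/-! ### The metric as a Euclidean inner product -/

theorem inner_eq_sum (z w : EuclideanSpace ℂ (Fin n)) :
    inner ℝ z w = ∑ k, ((z k).re * (w k).re + (z k).im * (w k).im) := by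
  simp only [PiLp.inner_apply, Complex.inner]
  refine Finset.sum_congr rfl fun k _ => ?_
  simp
  ring

theorem metric_eq (p u v : Heis n) :
    metric p u v = inner ℝ u.1 v.1 + theta p u * theta p v := by
  rw [metric, inner_eq_sum]

theorem imPair_eq_inner (z w : EuclideanSpace ℂ (Fin n)) :
    imPair z w = -inner ℝ (Complex.I • z) w := by
  rw [imPair_eq, inner_eq_sum, ← Finset.sum_neg_distrib]
  refine Finset.sum_congr rfl fun k _ => ?_
  simp
  ring

theorem inner_I_smul_self (z : EuclideanSpace ℂ (Fin n)) : inner ℝ (Complex.I • z) z = 0 := by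
  rw [inner_eq_sum]
  refine Finset.sum_eq_zero fun k _ => ?_
  simp
  ring

theorem inner_I_smul_left (z w : EuclideanSpace ℂ (Fin n)) :
    inner ℝ (Complex.I • z) w = -inner ℝ z (Complex.I • w) := by
  rw [inner_eq_sum, inner_eq_sum, ← Finset.sum_neg_distrib]
  refine Finset.sum_congr rfl fun k _ => ?_
  simp

theorem inner_I_smul_I_smul (z w : EuclideanSpace ℂ (Fin n)) :
    inner ℝ (Complex.I • z) (Complex.I • w) = inner ℝ z w := by
  rw [inner_I_smul_left, smul_smul, Complex.I_mul_I]
  simp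

theorem theta_eq (p u : Heis n) : theta p u = u.2 + inner ℝ (Complex.I • p.1) u.1 := by
  rw [theta, imPair_eq_inner, sub_neg_eq_add]

theorem theta_add (p u v : Heis n) : theta p (u + v) = theta p u + theta p v := by
  simp only [theta_eq, Prod.fst_add, Prod.snd_add, inner_add_right]
  ring

theorem theta_smul (p : Heis n) (a : ℝ) (u : Heis n) : theta p (a • u) = a * theta p u := by
  simp only [theta_eq, Prod.smul_fst, Prod.smul_snd, inner_smul_right, smul_eq_mul]
  ring

theorem theta_T (p q : Heis n) : theta p (T q) = 1 := by
  simp [theta_eq, T]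

theorem ofFrame_theta (p u : Heis n) : ofFrame p u.1 (theta p u) = u := by
  rw [ofFrame_eq, theta]
  simp

theorem ofFrame_fst (p : Heis n) (a : EuclideanSpace ℂ (Fin n)) (c : ℝ) :
    (ofFrame p a c).1 = a := by
  rw [ofFrame_eq]

theorem ext_frame {p u v : Heis n} (h1 : u.1 = v.1) (h2 : theta p u = theta p v) : u = v := by
  rw [← ofFrame_theta p u, ← ofFrame_theta p v, h1, h2]

/-- The horizontal hyperplane is the kernel of the contact form. -/
theorem horizontal_eq (p : Heis n) : horizontal p = {u | theta p u = 0} := by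
  ext u
  simp only [horizontal, SetLike.mem_coe, Set.mem_ofPred_eq]
  constructor
  · intro h
    induction h using Submodule.span_induction with
    | mem x hx =>
      rcases hx with ⟨k, rfl⟩ | ⟨k, rfl⟩
      · simp [theta, X, imPair]
      · simp [theta, Y, imPair, apply_ite Complex.im, apply_ite Complex.re]
    | zero => simp [theta_eq]
    | add x y _ _ hx hy => rw [theta_add, hx, hy, add_zero]
    | smul a x _ hx => rw [theta_smul, hx, mul_zero]
  · intro h
    rw [← ofFrame_theta p u, h, ofFrame, zero_smul, add_zero]
    refine Submodule.sum_mem _ fun k _ => Submodule.add_mem _ ?_ ?_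
    · exact Submodule.smul_mem _ _ (Submodule.subset_span (Or.inl ⟨k, rfl⟩))
    · exact Submodule.smul_mem _ _ (Submodule.subset_span (Or.inr ⟨k, rfl⟩))

/-- The coordinates of a tangent vector at `p` in the frame `X_k, Y_k, T`; this is an isometry from
the tangent space with the left-invariant metric onto the Euclidean space `ℂⁿ ⊕ ℝ`. -/
def frameCoord (p : Heis n) : Heis n ≃ₗ[ℝ] WithLp 2 (EuclideanSpace ℂ (Fin n) × ℝ) where
  toFun u := WithLp.toLp 2 (u.1, theta p u)
  invFun w := ofFrame p w.ofLp.1 w.ofLp.2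
  map_add' u v := by
    rw [theta_add]
    rfl
  map_smul' a u := by
    rw [theta_smul]
    rfl
  left_inv u := ofFrame_theta p u
  right_inv w := by
    simp only [theta_ofFrame, ofFrame_fst]

theorem inner_frameCoord (p u v : Heis n) :
    inner ℝ (frameCoord p u) (frameCoord p v) = metric p u v := by
  rw [metric_eq, WithLp.prod_inner_apply]
  simp [frameCoord, mul_comm]

theorem finrank_frame : Module.finrank ℝ (WithLp 2 (EuclideanSpace ℂ (Fin n) × ℝ)) = 2 * n + 1 := by
  rw [(WithLp.linearEquiv 2 ℝ (EuclideanSpace ℂ (Fin n) × ℝ)).finrank_eq, Module.finrank_prod,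
    finrank_real_of_complex]
  simp

theorem metric_comm (p u v : Heis n) : metric p u v = metric p v u := by
  rw [← inner_frameCoord, ← inner_frameCoord, real_inner_comm]

/-- An orthonormal family of `2n` vectors perpendicular to a unit vector `N` completes `N` to an
orthonormal basis; pairing a linear form with a vector in this basis gives a Parseval identity. -/
theorem sum_mul_metric {p N : Heis n} (hN : metric p N N = 1) {e : Fin (2 * n) → Heis n}
    (he : ∀ i j, metric p (e i) (e j) = if i = j then 1 else 0) (heN : ∀ i, metric p N (e i) = 0)
    (φ : Heis n →ₗ[ℝ] ℝ) (w : Heis n) :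
    ∑ i, φ (e i) * metric p w (e i) = φ w - φ N * metric p w N := by
  let v : Option (Fin (2 * n)) → WithLp 2 (EuclideanSpace ℂ (Fin n) × ℝ) := fun o =>
    frameCoord p (o.elim N e)
  have hv : Orthonormal ℝ v := by
    rw [orthonormal_iff_ite]
    rintro (_ | i) (_ | j) <;> simp only [v, inner_frameCoord, Option.elim]
    · simpa using hN
    · simpa using heN j
    · simpa [metric_comm p (e i)] using heN i
    · simpa using he i j
  have hcard : Fintype.card (Option (Fin (2 * n)))
      = Module.finrank ℝ (WithLp 2 (EuclideanSpace ℂ (Fin n) × ℝ)) := by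
    rw [finrank_frame]
    simp
  let b := (basisOfOrthonormalOfCardEqFinrank hv hcard).toOrthonormalBasis (by simpa using hv)
  have hb : ∀ o, b o = v o := fun o => by simp [b]
  have hw := b.sum_repr' (frameCoord p w)
  simp only [hb, v, inner_frameCoord, Fintype.sum_option, Option.elim] at hw
  have hw2 : metric p N w • N + ∑ i, metric p (e i) w • e i = w := by
    apply (frameCoord p).injective
    rw [map_add, map_sum]
    simpa only [map_smul] using hw
  have := congrArg φ hw2
  simp only [map_add, map_sum, map_smul, smul_eq_mul] at this
  rw [← this, metric_comm p w N]
  have hs : ∑ i, φ (e i) * metric p w (e i) = ∑ i, metric p (e i) w * φ (e i) :=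
    Finset.sum_congr rfl fun i _ => by rw [metric_comm p w, mul_comm]
  rw [hs]
  ring

theorem exists_orthonormal_perp {p N : Heis n} (hN : metric p N N = 1) :
    ∃ e : Fin (2 * n) → Heis n, (∀ i, metric p N (e i) = 0) ∧
      ∀ i j, metric p (e i) (e j) = if i = j then 1 else 0 := by
  have hN0 : frameCoord p N ≠ 0 := by
    intro h
    rw [← inner_frameCoord, h, inner_zero_left] at hN
    exact zero_ne_one hN
  have : Fact (Module.finrank ℝ (WithLp 2 (EuclideanSpace ℂ (Fin n) × ℝ)) = 2 * n + 1) :=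
    ⟨finrank_frame⟩
  have hf := Submodule.finrank_orthogonal_span_singleton (𝕜 := ℝ) (n := 2 * n) hN0
  let b := (stdOrthonormalBasis ℝ (ℝ ∙ frameCoord p N)ᗮ).reindex (finCongr hf)
  refine ⟨fun i => (frameCoord p).symm (b i), fun i => ?_, fun i j => ?_⟩
  · rw [← inner_frameCoord, LinearEquiv.apply_symm_apply]
    exact Submodule.mem_orthogonal_singleton_iff_inner_right.1 (b i).2
  · rw [← inner_frameCoord, LinearEquiv.apply_symm_apply, LinearEquiv.apply_symm_apply]
    have := orthonormal_iff_ite.1 b.orthonormal i j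
    simpa using this

/-- If a unit vector `N` is perpendicular to the kernel of `⟨G, ·⟩`, it is a multiple of `G`. -/
theorem eq_smul_of_perp {p N G : Heis n} (hN : metric p N N = 1) (hG : 0 < metric p G G)
    (h : ∀ u, metric p G u = 0 → metric p N u = 0) :
    metric p N G ^ 2 = metric p G G ∧ N = (metric p N G / metric p G G) • G := by
  have hsub : N - (metric p N G / metric p G G) • G = 0 := by
    have hu : metric p G (N - (metric p N G / metric p G G) • G) = 0 := by
      rw [← inner_frameCoord, map_sub, map_smul, inner_sub_right, inner_smul_right,
        inner_frameCoord, inner_frameCoord, metric_comm p N G]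
      field_simp
      ring
    have hNu := h _ hu
    apply (frameCoord p).injective
    rw [map_zero, ← inner_self_eq_zero (𝕜 := ℝ)]
    conv_lhs => arg 2; rw [map_sub, map_smul]
    rw [inner_sub_left, inner_smul_left, inner_frameCoord, inner_frameCoord, hu, hNu]
    simp
  have hN2 := sub_eq_zero.1 hsub
  refine ⟨?_, hN2⟩
  have h2 : metric p N N = metric p N G / metric p G G * metric p N G := by
    conv_lhs => arg 3; rw [hN2]
    rw [← inner_frameCoord, map_smul, inner_smul_right, inner_frameCoord]
  rw [hN] at h2
  field_simp at h2
  linarith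

/-! ### Orbits of the rotations about the axis -/

/-- `SO(2n)` acts transitively on the spheres of `ℂⁿ`: the reflection exchanging `z` and `w`
becomes a rotation after composition with the reflection in the hyperplane perpendicular to `iw`,
which fixes `w`. -/
theorem IsRotationallyInvariant.mem_of_norm_eq {S : Set (Heis n)} (hS : IsRotationallyInvariant S)
    {z w : EuclideanSpace ℂ (Fin n)} {t : ℝ} (h : ‖z‖ = ‖w‖) (hz : (z, t) ∈ S) : (w, t) ∈ S := by
  by_cases hzw : z = w
  · rwa [← hzw]
  have hw : w ≠ 0 := by
    rintro rfl
    rw [norm_zero, norm_eq_zero] at h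
    exact hzw h
  let R₁ : EuclideanSpace ℂ (Fin n) ≃ₗᵢ[ℝ] EuclideanSpace ℂ (Fin n) := (ℝ ∙ (z - w))ᗮ.reflection
  let R₂ : EuclideanSpace ℂ (Fin n) ≃ₗᵢ[ℝ] EuclideanSpace ℂ (Fin n) :=
    (ℝ ∙ (Complex.I • w))ᗮ.reflection
  have h1 : R₁ z = w := Submodule.reflection_sub h
  have h2 : R₂ w = w := by
    apply Submodule.reflection_mem_subspace_eq_self
    exact Submodule.mem_orthogonal_singleton_iff_inner_right.2 (inner_I_smul_self w)
  have hdet : ∀ v : EuclideanSpace ℂ (Fin n), v ≠ 0 →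
      LinearMap.det ((ℝ ∙ v)ᗮ.reflection.toLinearEquiv :
        EuclideanSpace ℂ (Fin n) →ₗ[ℝ] EuclideanSpace ℂ (Fin n)) = -1 := by
    intro v hv
    rw [Submodule.det_reflection, Submodule.orthogonal_orthogonal, finrank_span_singleton hv,
      pow_one]
  have hd : LinearMap.det ((R₁.trans R₂).toLinearEquiv :
        EuclideanSpace ℂ (Fin n) →ₗ[ℝ] EuclideanSpace ℂ (Fin n)) = 1 := by
    have : ((R₁.trans R₂).toLinearEquiv :
        EuclideanSpace ℂ (Fin n) →ₗ[ℝ] EuclideanSpace ℂ (Fin n))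
        = (R₂.toLinearEquiv : EuclideanSpace ℂ (Fin n) →ₗ[ℝ] EuclideanSpace ℂ (Fin n)) ∘ₗ
          (R₁.toLinearEquiv : EuclideanSpace ℂ (Fin n) →ₗ[ℝ] EuclideanSpace ℂ (Fin n)) := rfl
    rw [this, LinearMap.det_comp, hdet _ (sub_ne_zero.2 hzw),
      hdet _ (smul_ne_zero Complex.I_ne_zero hw)]
    norm_num
  rw [← hS _ hd]
  exact ⟨(z, t), hz, by simp [h1, h2]⟩

end Heis

/-! ### Level sets and locally constant functions -/

/-- Every vector in the kernel of the differential is the velocity of a curve in the level set. -/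
theorem HasStrictFDerivAt.exists_curve {E : Type*} [NormedAddCommGroup E] [NormedSpace ℝ E]
    [CompleteSpace E] {F : E → ℝ} {F' : E →L[ℝ] ℝ} {p : E} (hF : HasStrictFDerivAt F F' p)
    (hF' : F' ≠ 0) {u : E} (hu : F' u = 0) :
    ∃ c : ℝ → E, c 0 = p ∧ (∀ᶠ s in 𝓝 (0 : ℝ), F (c s) = F p) ∧ HasDerivAt c u 0 := by
  have hr : F'.range = ⊤ := by
    rw [LinearMap.range_eq_top]
    exact LinearMap.surjective_of_ne_zero (fun h => hF' (ContinuousLinearMap.coe_injective h))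
  let ι : ℝ → F'.ker := fun s => s • ⟨u, hu⟩
  have hι : Filter.Tendsto (fun s => (F p, ι s)) (𝓝 0) (𝓝 (F p, 0)) := by
    have : Continuous fun s => (F p, ι s) := by fun_prop
    simpa only [ι, zero_smul] using this.tendsto 0
  refine ⟨fun s => hF.implicitFunction F F' hr (F p) (ι s), ?_, ?_, ?_⟩
  · simp [ι]
  · exact hι.eventually (hF.map_implicitFunction_eq hr)
  · have h1 : HasFDerivAt (hF.implicitFunction F F' hr (F p)) F'.ker.subtypeL (ι 0) := by
      simpa [ι] using (hF.to_implicitFunction hr).hasFDerivAt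
    have h2 : HasDerivAt ι ⟨u, hu⟩ 0 := by
      simpa [ι] using (hasDerivAt_id (0 : ℝ)).smul_const (⟨u, hu⟩ : F'.ker)
    exact h1.comp_hasDerivAt 0 h2

/-- A function whose differential vanishes on the tangent spaces of a regular level set is locally
constant on it. -/
theorem ContDiffAt.eventually_eq_of_ker_fderiv_le {E : Type*} [NormedAddCommGroup E]
    [NormedSpace ℝ E] [CompleteSpace E] {g F : E → ℝ} {p : E} (hg : ContDiffAt ℝ 1 g p)
    (hg' : fderiv ℝ g p ≠ 0) (hF : ∀ᶠ q in 𝓝 p, DifferentiableAt ℝ F q)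
    (h : ∀ᶠ q in 𝓝 p, g q = g p → ∀ u, fderiv ℝ g q u = 0 → fderiv ℝ F q u = 0) :
    ∀ᶠ q in 𝓝 p, g q = g p → F q = F p := by
  obtain ⟨v, hv⟩ : ∃ v, fderiv ℝ g p v ≠ 0 := by
    by_contra! h0
    exact hg' (ContinuousLinearMap.ext h0)
  -- near `p` the level set is the graph `y = φ x` in the coordinates `p + x + y v`
  let L : E × ℝ →L[ℝ] E :=
    ContinuousLinearMap.fst ℝ E ℝ + (ContinuousLinearMap.snd ℝ E ℝ).smulRight v
  let G : E × ℝ → ℝ := fun x => g (p + L x)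
  have hL0 : p + L (0, 0) = p := by simp [L]
  have hG : ContDiffAt ℝ 1 G (0, 0) := by
    refine ContDiffAt.comp (g := g) _ (by rwa [hL0]) ?_
    exact contDiffAt_const.add L.contDiff.contDiffAt
  have hGd : fderiv ℝ G (0, 0) = (fderiv ℝ g p).comp L := by
    have h1 : HasFDerivAt g (fderiv ℝ g p) (p + L (0, 0)) := by
      rw [hL0]
      exact (hg.differentiableAt one_ne_zero).hasFDerivAt
    exact (h1.comp (0, 0) (L.hasFDerivAt.const_add p)).fderiv
  have hinv : (fderiv ℝ G (0, 0) ∘L .inr ℝ E ℝ).IsInvertible := by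
    have : fderiv ℝ G (0, 0) ∘L .inr ℝ E ℝ
        = ((ContinuousLinearEquiv.unitsEquivAut ℝ (Units.mk0 _ hv) : ℝ ≃L[ℝ] ℝ) : ℝ →L[ℝ] ℝ) := by
      ext
      simp [hGd, L]
    rw [this]
    exact ContinuousLinearMap.isInvertible_equiv
  set φ := hG.implicitFunction one_ne_zero hinv with hφ
  have hφ0 : φ 0 = 0 := hG.implicitFunction_apply_self one_ne_zero hinv
  have hφd : ContDiffAt ℝ 1 φ 0 := hG.contDiffAt_implicitFunction one_ne_zero hinv
  have hφG := hG.eventually_apply_implicitFunction one_ne_zero hinv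
  have hφiff := hG.eventually_apply_eq_iff_implicitFunction one_ne_zero hinv
  rw [← hφ] at hφG hφiff
  have hGp : G (0, 0) = g p := by simp only [G, hL0]
  let γ : E → E := fun x => p + L (x, φ x)
  have hγ0 : γ 0 = p := by simp only [γ, hφ0, hL0]
  have hγd : ContDiffAt ℝ 1 γ 0 := by
    refine contDiffAt_const.add (L.contDiff.contDiffAt.comp 0 (contDiffAt_id.prodMk hφd))
  have hγt : Filter.Tendsto γ (𝓝 0) (𝓝 p) := by
    have := hγd.continuousAt.tendsto
    rwa [hγ0] at this
  have hgd : ∀ᶠ q in 𝓝 p, DifferentiableAt ℝ g q :=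
    (hg.eventually (by simp)).mono fun q hq => hq.differentiableAt one_ne_zero
  have hlevel : ∀ᶠ x in 𝓝 (0 : E), g (γ x) = g p := hφG.mono fun x hx => by rw [← hGp, ← hx]
  have hzero : ∀ᶠ x in 𝓝 (0 : E), HasFDerivAt (fun x => F (γ x)) (0 : E →L[ℝ] ℝ) x := by
    filter_upwards [hγt.eventually hgd, hγt.eventually hF, hγt.eventually h, hlevel,
      hlevel.eventually_nhds, (hγd.eventually (by simp))] with x h1 h2 h3 h4 h5 h6
    have hγx := (h6.differentiableAt one_ne_zero).hasFDerivAt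
    have e1 := h1.hasFDerivAt.comp x hγx
    have e2 : HasFDerivAt (g ∘ γ) (0 : E →L[ℝ] ℝ) x :=
      (hasFDerivAt_const (g p) x).congr_of_eventuallyEq h5
    have e3 := e1.unique e2
    have e4 := h2.hasFDerivAt.comp x hγx
    have e5 : (fderiv ℝ F (γ x)).comp (fderiv ℝ γ x) = 0 := by
      ext u
      exact h3 h4 _ (DFunLike.congr_fun e3 u)
    rw [e5] at e4
    exact e4
  obtain ⟨ε, hε, hball⟩ := Metric.eventually_nhds_iff_ball.1 hzero
  have hconst : ∀ x ∈ Metric.ball (0 : E) ε, F (γ x) = F p := by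
    intro x hx
    have := (convex_ball (0 : E) ε).is_const_of_fderivWithin_eq_zero (𝕜 := ℝ)
      (f := fun x => F (γ x)) (fun y hy => (hball y hy).differentiableAt.differentiableWithinAt)
      (fun y hy => ((hball y hy).hasFDerivWithinAt).fderivWithin
        ((Metric.isOpen_ball.uniqueDiffOn) y hy)) hx (Metric.mem_ball_self hε)
    simpa [hγ0] using this
  -- a point `q` of the level set near `p` has coordinates `(q - p, 0)`
  have hsub : Filter.Tendsto (fun q => (q - p, (0 : ℝ))) (𝓝 p) (𝓝 (0, 0)) := by
    have : Continuous fun q : E => (q - p, (0 : ℝ)) := by fun_prop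
    simpa using this.tendsto p
  have hsub1 : Filter.Tendsto (fun q => q - p) (𝓝 p) (𝓝 0) := by
    have : Continuous fun q : E => q - p := by fun_prop
    simpa using this.tendsto p
  filter_upwards [hsub.eventually hφiff, hsub1.eventually (Metric.ball_mem_nhds 0 hε)]
    with q hq1 hq2 hq
  have e : G (q - p, 0) = G (0, 0) := by
    rw [hGp, ← hq]
    simp [G, L]
  have e2 := hq1.1 e
  have := hconst _ hq2
  simp only [γ] at this
  rw [← this]
  rw [e2]
  simp [L]

/-- A continuous real function on a connected set that is locally constant outside a countable set
takes countably many values, hence is constant. -/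
theorem IsPreconnected.eq_of_locallyConst_off_countable {X : Type*} [TopologicalSpace X]
    [SecondCountableTopology X] {S A : Set X} (hS : IsPreconnected S) {F : X → ℝ}
    (hF : ContinuousOn F S) (hA : A.Countable)
    (h : ∀ p ∈ S \ A, ∀ᶠ q in 𝓝[S] p, F q = F p) {p q : X} (hp : p ∈ S) (hq : q ∈ S) :
    F p = F q := by
  have hcount : (F '' S).Countable := by
    have h' : ∀ p ∈ S \ A, {q | F q = F p} ∈ 𝓝[S \ A] p := fun p hp =>
      nhdsWithin_mono p Set.sdiff_subset (h p hp)
    obtain ⟨t, -, htc, ht⟩ := TopologicalSpace.countable_cover_nhdsWithin h'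
    refine ((htc.union hA).image F).mono ?_
    rintro _ ⟨x, hx, rfl⟩
    by_cases hxA : x ∈ A
    · exact ⟨x, Or.inr hxA, rfl⟩
    · obtain ⟨y, hy, hxy⟩ := Set.mem_iUnion₂.1 (ht ⟨hx, hxA⟩)
      exact ⟨y, Or.inl hy, hxy.symm⟩
  exact hcount.isTotallyDisconnected (F '' S) subset_rfl (hS.image F hF) (Set.mem_image_of_mem F hp)
    (Set.mem_image_of_mem F hq)

namespace Heis

variable {n : ℕ}

/-! ### Tangent spaces and the divergence along a hypersurface -/

theorem tangent_subset_ker {S : Set (Heis n)} {p : Heis n} {F : Heis n → ℝ}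
    {F' : Heis n →L[ℝ] ℝ} (hF : HasFDerivAt F F' p) (hS : ∀ᶠ q in 𝓝 p, q ∈ S → F q = 0)
    {u : Heis n} (hu : u ∈ tangent S p) : F' u = 0 := by
  obtain ⟨c, rfl, hc, hcu⟩ := hu
  have h1 := hF.comp_hasDerivAt 0 hcu
  have h2 : ∀ᶠ s in 𝓝 (0 : ℝ), F (c s) = 0 := by
    filter_upwards [hc, hcu.continuousAt.eventually hS] with s h1 h2 using h2 h1
  exact h1.unique ((hasDerivAt_const (0 : ℝ) (0 : ℝ)).congr_of_eventuallyEq h2)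

theorem tangent_eq_ker {S : Set (Heis n)} {p : Heis n} (hp : p ∈ S) {F : Heis n → ℝ}
    {F' : Heis n →L[ℝ] ℝ} (hF : HasStrictFDerivAt F F' p) (hF' : F' ≠ 0)
    (hS : ∀ᶠ q in 𝓝 p, q ∈ S ↔ F q = 0) : tangent S p = {u | F' u = 0} := by
  ext u
  refine ⟨tangent_subset_ker hF.hasFDerivAt (hS.mono fun q hq => hq.1), fun hu => ?_⟩
  obtain ⟨c, hc0, hc, hcu⟩ := hF.exists_curve hF' hu
  refine ⟨c, hc0, ?_, hcu⟩
  have ht : Filter.Tendsto c (𝓝 0) (𝓝 p) := by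
    have := hcu.continuousAt.tendsto
    rwa [hc0] at this
  filter_upwards [hc, ht.eventually hS] with s h1 h2
  rw [h2, h1, ← hS.self_of_nhds]
  exact hp

/-- Tangential derivatives of a vector field depend only on its values on the hypersurface. -/
theorem covDeriv_congr {S : Set (Heis n)} {p : Heis n} {V W : Heis n → Heis n}
    (hV : DifferentiableAt ℝ V p) (hW : DifferentiableAt ℝ W p)
    (h : ∀ᶠ q in 𝓝[S] p, V q = W q) (hp : p ∈ S) {u : Heis n} (hu : u ∈ tangent S p) :
    covDeriv V p u = covDeriv W p u := by
  have hVW : V p = W p := h.self_of_nhdsWithin hp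
  have key : ∀ {G : Type} [NormedAddCommGroup G] [NormedSpace ℝ G] {a b : Heis n → G},
      DifferentiableAt ℝ a p → DifferentiableAt ℝ b p → (∀ q, V q = W q → a q = b q) →
      fderiv ℝ a p u = fderiv ℝ b p u := by
    intro G _ _ a b ha hb hab
    obtain ⟨c, rfl, hc, hcu⟩ := hu
    have h1 := ha.hasFDerivAt.comp_hasDerivAt 0 hcu
    have h2 := hb.hasFDerivAt.comp_hasDerivAt 0 hcu
    have h3 : ∀ᶠ s in 𝓝 (0 : ℝ), (a ∘ c) s = (b ∘ c) s := by
      have ht : Filter.Tendsto c (𝓝 0) (𝓝[S] (c 0)) :=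
        tendsto_nhdsWithin_iff.2 ⟨hcu.continuousAt, hc⟩
      exact (ht.eventually h).mono fun s hs => hab _ hs
    exact h1.unique (h2.congr_of_eventuallyEq h3)
  rw [covDeriv, covDeriv, hVW, key hV.fst hW.fst (fun q hq => by rw [hq]),
    key (fderiv_theta hV).1 (fderiv_theta hW).1 (fun q hq => by rw [hq])]

/-! ### Rotationally symmetric horizontal fields -/

/-- The point `(|z|, t)` of the profile half-plane. -/
def prof (q : Heis n) : ℝ × ℝ := (‖q.1‖, q.2)

/-- The horizontal field `((c + i s) / |z|) z` in frame coordinates, with `c` and `s` functions on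
the profile half-plane. For `c² + s² = 1` these are the rotationally symmetric unit horizontal
fields. -/
def radialField (c s : ℝ × ℝ → ℝ) (q : Heis n) : Heis n :=
  ofFrame q ((c (prof q) / ‖q.1‖) • q.1 + (s (prof q) / ‖q.1‖) • (Complex.I • q.1)) 0

theorem contDiffAt_prof {p : Heis n} (hp : p.1 ≠ 0) {k : WithTop ℕ∞} : ContDiffAt ℝ k prof p :=
  ((contDiffAt_fst (𝕜 := ℝ)).norm ℝ hp).prodMk contDiffAt_snd

theorem continuous_prof : Continuous (prof : Heis n → ℝ × ℝ) := by
  unfold prof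
  fun_prop

theorem hasFDerivAt_norm {z : EuclideanSpace ℂ (Fin n)} (hz : z ≠ 0) :
    HasFDerivAt (fun w : EuclideanSpace ℂ (Fin n) => ‖w‖) (‖z‖⁻¹ • innerSL ℝ z) z := by
  have h1 := (hasStrictFDerivAt_norm_sq z).hasFDerivAt.sqrt (by simpa using hz)
  simp only [Real.sqrt_sq (norm_nonneg _)] at h1
  convert! h1 using 1
  ext u
  simp
  have : ‖z‖ ≠ 0 := norm_ne_zero_iff.2 hz
  field_simp

/-- The differential of `[z, t] ↦ (|z|, t)`. -/
def profDeriv (p : Heis n) : Heis n →L[ℝ] ℝ × ℝ :=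
  ((‖p.1‖⁻¹ • innerSL ℝ p.1).comp (ContinuousLinearMap.fst ℝ _ _)).prod
    (ContinuousLinearMap.snd ℝ _ _)

theorem profDeriv_apply (p u : Heis n) : profDeriv p u = (‖p.1‖⁻¹ * inner ℝ p.1 u.1, u.2) := rfl

theorem hasFDerivAt_prof {p : Heis n} (hp : p.1 ≠ 0) : HasFDerivAt prof (profDeriv p) p :=
  ((hasFDerivAt_norm hp).comp p hasFDerivAt_fst).prodMk hasFDerivAt_snd

theorem radialField_fst (c s : ℝ × ℝ → ℝ) (q : Heis n) :
    (radialField c s q).1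
      = (c (prof q) / ‖q.1‖) • q.1 + (s (prof q) / ‖q.1‖) • (Complex.I • q.1) :=
  ofFrame_fst _ _ _

theorem theta_radialField (c s : ℝ × ℝ → ℝ) (q : Heis n) : theta q (radialField c s q) = 0 :=
  theta_ofFrame _ _ _

theorem inner_radialField {c s : ℝ × ℝ → ℝ} {q : Heis n} (hq : q.1 ≠ 0)
    (h : c (prof q) ^ 2 + s (prof q) ^ 2 = 1) :
    inner ℝ (radialField c s q).1 (radialField c s q).1 = 1 := by
  have hr : ‖q.1‖ ≠ 0 := norm_ne_zero_iff.2 hq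
  rw [radialField_fst]
  simp only [inner_add_left, inner_add_right, inner_smul_left, inner_smul_right,
    real_inner_self_eq_norm_sq, inner_I_smul_self, real_inner_comm (Complex.I • q.1) q.1,
    norm_smul, Complex.norm_I, one_mul, conj_trivial]
  field_simp
  linear_combination ‖q.1‖ ^ 2 * h

/-- Multiplication by `i` as a real continuous linear map of `ℂⁿ`. -/
def mulI : EuclideanSpace ℂ (Fin n) →L[ℝ] EuclideanSpace ℂ (Fin n) :=
  (Complex.I • ContinuousLinearMap.id ℂ (EuclideanSpace ℂ (Fin n))).restrictScalars ℝ

theorem mulI_apply (z : EuclideanSpace ℂ (Fin n)) : mulI z = Complex.I • z := rfl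

theorem hasFDerivAt_div_norm {f : ℝ × ℝ → ℝ} {f' : ℝ × ℝ →L[ℝ] ℝ} {p : Heis n} (hp : p.1 ≠ 0)
    (hf : HasFDerivAt f f' (prof p)) :
    ∃ L : Heis n →L[ℝ] ℝ, HasFDerivAt (fun q : Heis n => f (prof q) / ‖q.1‖) L p ∧
      ∀ u, L u = f' (profDeriv p u) / ‖p.1‖ - f (prof p) * inner ℝ p.1 u.1 / ‖p.1‖ ^ 3 := by
  have h1 : HasFDerivAt (fun q => f (prof q)) _ p := hf.comp p (hasFDerivAt_prof hp)
  have h2 : HasFDerivAt (fun q : Heis n => ‖q.1‖) _ p :=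
    (hasFDerivAt_norm hp).comp p (hasFDerivAt_fst (𝕜 := ℝ))
  have hr : ‖p.1‖ ≠ 0 := norm_ne_zero_iff.2 hp
  have h3 := h1.fun_mul ((hasDerivAt_inv hr).comp_hasFDerivAt p h2)
  refine ⟨_, h3, fun u => ?_⟩
  simp
  field_simp
  ring

theorem hasFDerivAt_radialField {c s : ℝ × ℝ → ℝ} {c' s' : ℝ × ℝ →L[ℝ] ℝ} {p : Heis n}
    (hp : p.1 ≠ 0) (hc : HasFDerivAt c c' (prof p)) (hs : HasFDerivAt s s' (prof p)) :
    DifferentiableAt ℝ (radialField c s) p ∧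
    ∀ u, fderiv ℝ (fun q => (radialField c s q).1) p u
      = (c' (profDeriv p u) / ‖p.1‖ - c (prof p) * inner ℝ p.1 u.1 / ‖p.1‖ ^ 3) • p.1
        + (s' (profDeriv p u) / ‖p.1‖ - s (prof p) * inner ℝ p.1 u.1 / ‖p.1‖ ^ 3)
          • (Complex.I • p.1)
        + (c (prof p) / ‖p.1‖) • u.1 + (s (prof p) / ‖p.1‖) • (Complex.I • u.1) := by
  obtain ⟨L, hL, hLu⟩ := hasFDerivAt_div_norm hp hc
  obtain ⟨M, hM, hMu⟩ := hasFDerivAt_div_norm hp hs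
  have h1 := (hL.smul (hasFDerivAt_fst (𝕜 := ℝ))).add
    (hM.smul ((mulI (n := n)).hasFDerivAt.comp p (hasFDerivAt_fst (𝕜 := ℝ))))
  have h2 : HasFDerivAt (fun q => (radialField c s q).1) _ p :=
    h1.congr_of_eventuallyEq (Filter.Eventually.of_forall fun q => radialField_fst c s q)
  have h3 := (fderiv_imPair (differentiableAt_fst (𝕜 := ℝ) (p := p)) h2.differentiableAt).1
  refine ⟨?_, fun u => ?_⟩
  · have : radialField c s = fun q : Heis n =>
        ((radialField c s q).1, imPair q.1 (radialField c s q).1) := by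
      funext q
      conv_lhs => rw [radialField, ofFrame_eq, zero_add]
      rw [radialField_fst]
    rw [this]
    exact h2.differentiableAt.prodMk h3
  · rw [h2.fderiv]
    simp [hLu, hMu, mulI_apply]
    abel

/-- The divergence of a rotationally symmetric unit horizontal field along a hypersurface with
unit normal `N`, when the field is parallel to the horizontal part of `N`. -/
theorem sum_covDeriv_radialField {c s : ℝ × ℝ → ℝ} {c' s' : ℝ × ℝ →L[ℝ] ℝ} {p N : Heis n}
    (hp : p.1 ≠ 0) (hc : HasFDerivAt c c' (prof p)) (hs : HasFDerivAt s s' (prof p))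
    (hcs : ∀ᶠ x in 𝓝 (prof p), c x ^ 2 + s x ^ 2 = 1) (hN : metric p N N = 1) {κ : ℝ}
    (hNκ : N.1 = κ • (radialField c s p).1) {e : Fin (2 * n) → Heis n}
    (he : ∀ i j, metric p (e i) (e j) = if i = j then 1 else 0)
    (heN : ∀ i, metric p N (e i) = 0) :
    ∑ i, metric p (covDeriv (radialField c s) p (e i)) (e i)
      = (2 * n - 1) * c (prof p) / ‖p.1‖
        - (c (prof p) * s' (s (prof p), ‖p.1‖ * c (prof p))
          - s (prof p) * c' (s (prof p), ‖p.1‖ * c (prof p))) := by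
  obtain ⟨hV, hVd⟩ := hasFDerivAt_radialField hp hc hs
  have hr : ‖p.1‖ ≠ 0 := norm_ne_zero_iff.2 hp
  have hcs0 := hcs.self_of_nhds
  set C := c (prof p)
  set D := s (prof p)
  set r := ‖p.1‖ with hrdef
  set z := p.1
  -- differentiating `c² + s² = 1`
  have hcs' : ∀ x, C * c' x + D * s' x = 0 := by
    intro x
    have h1 := (hc.fun_mul hc).fun_add (hs.fun_mul hs)
    have h2 : HasFDerivAt (fun x => c x * c x + s x * s x) (0 : ℝ × ℝ →L[ℝ] ℝ) (prof p) :=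
      (hasFDerivAt_const (1 : ℝ) (prof p)).congr_of_eventuallyEq
        (hcs.mono fun x hx => by rw [← hx]; ring)
    have := DFunLike.congr_fun (h1.unique h2) x
    simp at this
    linarith
  have hzz : inner ℝ z z = r ^ 2 := real_inner_self_eq_norm_sq z
  have hIz : inner ℝ (Complex.I • z) z = 0 := inner_I_smul_self z
  have hzI : inner ℝ z (Complex.I • z) = 0 := by rw [real_inner_comm, hIz]
  have hII : inner ℝ (Complex.I • z) (Complex.I • z) = r ^ 2 := by rw [inner_I_smul_I_smul, hzz]
  have hmet : ∀ w u, metric p (ofFrame p w 0) u = inner ℝ w u.1 := by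
    intro w u
    rw [metric_eq, ofFrame_fst, theta_ofFrame, zero_mul, add_zero]
  have hmetT : ∀ u, metric p (T p) u = theta p u := by
    intro u
    rw [metric_eq, theta_T]
    simp [T]
  let Lα : Heis n →ₗ[ℝ] ℝ := (r⁻¹ • (c'.comp (profDeriv p)).toLinearMap
    - (C / r ^ 3) • ((innerSL ℝ z).comp (ContinuousLinearMap.fst ℝ _ ℝ)).toLinearMap)
  let Lβ : Heis n →ₗ[ℝ] ℝ := (r⁻¹ • (s'.comp (profDeriv p)).toLinearMap
    - (D / r ^ 3) • ((innerSL ℝ z).comp (ContinuousLinearMap.fst ℝ _ ℝ)).toLinearMap)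
  let Lθ : Heis n →ₗ[ℝ] ℝ := ⟨⟨theta p, theta_add p⟩, theta_smul p⟩
  have hLα : ∀ u, Lα u = c' (profDeriv p u) / r - C * inner ℝ z u.1 / r ^ 3 := by
    intro u
    simp [Lα]
    ring
  have hLβ : ∀ u, Lβ u = s' (profDeriv p u) / r - D * inner ℝ z u.1 / r ^ 3 := by
    intro u
    simp [Lβ]
    ring
  have hLθ : ∀ u, Lθ u = theta p u := fun u => rfl
  set V₁ : EuclideanSpace ℂ (Fin n) := (C / r) • z + (D / r) • (Complex.I • z) with hV₁
  have hVp : (radialField c s p).1 = V₁ := radialField_fst c s p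
  have hVV : inner ℝ V₁ V₁ = 1 := by
    rw [← hVp]
    exact inner_radialField hp hcs0
  have hθV : (fun q : Heis n => theta q (radialField c s q)) = fun _ => 0 := by
    funext q
    exact theta_radialField c s q
  -- each summand of the divergence is a sum of products of linear forms in `e i`, so that
  -- `sum_mul_metric` evaluates the trace
  have hterm : ∀ u, metric p u u = 1 → metric p (covDeriv (radialField c s) p u) u
      = Lα u * metric p (ofFrame p z 0) u + Lβ u * metric p (ofFrame p (Complex.I • z) 0) u
        + C / r * (1 - Lθ u * metric p (T p) u)
        + 2 * (Lθ u * metric p (ofFrame p (Complex.I • V₁) 0) u) := by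
    intro u hu
    rw [metric_eq] at hu
    rw [metric_eq, covDeriv, theta_ofFrame, ofFrame_fst, hVd, hθV, theta_radialField,
      fderiv_fun_const, hVp, hmet, hmet, hmet, hmetT, hLα, hLβ, hLθ, imPair_eq_inner]
    simp only [inner_add_left, inner_smul_left, conj_trivial, zero_smul, add_zero,
      smul_comm Complex.I (theta p u), inner_I_smul_self]
    rw [Pi.zero_apply, _root_.zero_apply]
    linear_combination (C / r) * hu
  rw [Finset.sum_congr rfl fun i _ => hterm (e i) (by simpa using he i i)]
  simp only [Finset.sum_add_distrib, ← Finset.mul_sum, Finset.sum_sub_distrib]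
  rw [sum_mul_metric hN he heN, sum_mul_metric hN he heN, sum_mul_metric hN he heN,
    sum_mul_metric hN he heN]
  have hNθ : κ ^ 2 + theta p N ^ 2 = 1 := by
    rw [metric_eq, hNκ, hVp, inner_smul_left, inner_smul_right, hVV] at hN
    simp at hN
    linarith
  have hzN : inner ℝ z N.1 = κ * C * r := by
    rw [hNκ, hVp, inner_smul_right, hV₁, inner_add_right, inner_smul_right, inner_smul_right, hzz,
      hzI]
    field_simp
    ring
  have hIzN : inner ℝ (Complex.I • z) N.1 = κ * D * r := by
    rw [hNκ, hVp, inner_smul_right, hV₁, inner_add_right, inner_smul_right, inner_smul_right, hIz,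
      hII]
    field_simp
    ring
  have hIVN : inner ℝ (Complex.I • V₁) N.1 = 0 := by
    rw [hNκ, hVp, inner_smul_right, inner_I_smul_self, mul_zero]
  have hπ1 : profDeriv p (ofFrame p z 0) = (r, 0) := by
    rw [profDeriv_apply, ofFrame_eq, imPair_eq_inner]
    simp only
    rw [hzz, hIz, ← hrdef]
    ext
    · simp only
      field_simp
    · simp
  have hπ2 : profDeriv p (ofFrame p (Complex.I • z) 0) = (0, -r ^ 2) := by
    rw [profDeriv_apply, ofFrame_eq, imPair_eq_inner]
    simp only
    rw [hzI, hII]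
    simp
  have hsplit : ∀ (f : ℝ × ℝ →L[ℝ] ℝ) (x y : ℝ), f (x, y) = x * f (1, 0) + y * f (0, 1) := by
    intro f x y
    have : ((x, y) : ℝ × ℝ) = x • (1, 0) + y • (0, 1) := by ext <;> simp
    rw [this, map_add, map_smul, map_smul]
    rfl
  rw [hmet, hmet, hmet, hmetT, hLα, hLα, hLβ, hLβ, hLθ, hLθ, hLθ, hπ1, hπ2, hzN, hIzN, hIVN,
    theta_ofFrame, theta_T, ofFrame_fst, ofFrame_fst, hzz, hzI, hsplit c' r, hsplit s' 0,
    hsplit c' D, hsplit s' D]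
  have h10 := hcs' (1, 0)
  have h01 := hcs' (0, 1)
  have hN' := hcs' (profDeriv p N)
  simp
  field_simp
  linear_combination (-κ * r) * hN' + (κ ^ 2 * C - r * c' (1, 0) + r ^ 2 * s' (0, 1)) * hcs0
    + C * hNθ + (r * C) * h10 - (r ^ 2 * D) * h01

/-- The divergence of the horizontal unit normal of a rotationally symmetric hypersurface. -/
theorem hasDivAlong_iff {S : Set (Heis n)} {N : Heis n → Heis n} {p : Heis n} {c s : ℝ × ℝ → ℝ}
    (hpS : p ∈ S) (hp : p.1 ≠ 0) (hc : DifferentiableAt ℝ c (prof p))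
    (hs : DifferentiableAt ℝ s (prof p)) (hcs : ∀ᶠ x in 𝓝 (prof p), c x ^ 2 + s x ^ 2 = 1)
    (hν : ∀ᶠ q in 𝓝[S] p, horizontalNormal N q = radialField c s q)
    (hN : metric p (N p) (N p) = 1) (hT : tangent S p = {u | metric p (N p) u = 0}) (d : ℝ) :
    HasDivAlong S (horizontalNormal N) p d ↔
      d = (2 * n - 1) * c (prof p) / ‖p.1‖
        - (c (prof p) * fderiv ℝ s (prof p) (s (prof p), ‖p.1‖ * c (prof p))
          - s (prof p) * fderiv ℝ c (prof p) (s (prof p), ‖p.1‖ * c (prof p))) := by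
  have hV := (hasFDerivAt_radialField hp hc.hasFDerivAt hs.hasFDerivAt).1
  obtain ⟨κ, hκ⟩ : ∃ κ : ℝ, (N p).1 = κ • (radialField c s p).1 := by
    have h1 : (radialField c s p).1 = (horizontalNormal N p).1 := by
      rw [hν.self_of_nhdsWithin hpS]
    have h2 : (hproj p (N p)).1 = (N p).1 := by simp [hproj, T]
    rw [horizontalNormal, Prod.smul_fst, h2] at h1
    set w := Real.sqrt (metric p (hproj p (N p)) (hproj p (N p)))
    refine ⟨w, ?_⟩
    have hw : w ≠ 0 := by
      intro hw
      have h3 := inner_radialField hp hcs.self_of_nhds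
      rw [h1, hw] at h3
      simp at h3
    rw [h1, smul_smul, mul_inv_cancel₀ hw, one_smul]
  have key : ∀ e : Fin (2 * n) → Heis n, (∀ i, e i ∈ tangent S p) →
      (∀ i j, metric p (e i) (e j) = if i = j then 1 else 0) → _ := fun e h1 h2 =>
    sum_covDeriv_radialField hp hc.hasFDerivAt hs.hasFDerivAt hcs hN hκ h2
      (fun i => by simpa [hT] using h1 i)
  constructor
  · rintro ⟨V, hVd, hVν, e, he1, he2, rfl⟩
    rw [← key e he1 he2]
    refine Finset.sum_congr rfl fun i _ => ?_
    rw [covDeriv_congr hVd hV _ hpS (he1 i)]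
    filter_upwards [hVν, hν] with q h1 h2
    rw [h1, h2]
  · rintro rfl
    obtain ⟨e, he1, he2⟩ := exists_orthonormal_perp hN
    have he3 : ∀ i, e i ∈ tangent S p := fun i => by
      rw [hT]
      exact he1 i
    exact ⟨radialField c s, hV, hν.mono fun q hq => hq.symm, e, he3, he2, (key e he3 he2).symm⟩

/-! ### Profile functions -/

/-- The partial derivative of `g` in the radial variable. -/
def dr (g : ℝ × ℝ → ℝ) (x : ℝ × ℝ) : ℝ := fderiv ℝ g x (1, 0)

/-- The partial derivative of `g` in the vertical variable. -/
def dt (g : ℝ × ℝ → ℝ) (x : ℝ × ℝ) : ℝ := fderiv ℝ g x (0, 1)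

theorem fderiv_eq_dr_dt (g : ℝ × ℝ → ℝ) (x v : ℝ × ℝ) :
    fderiv ℝ g x v = v.1 * dr g x + v.2 * dt g x := by
  have : v = v.1 • ((1, 0) : ℝ × ℝ) + v.2 • (0, 1) := by ext <;> simp
  conv_lhs => rw [this]
  rw [map_add, map_smul, map_smul]
  rfl

/-- The Riemannian gradient at `q` of `[z, t] ↦ g (|z|, t)`. -/
def grad (g : ℝ × ℝ → ℝ) (q : Heis n) : Heis n :=
  ofFrame q ((dr g (prof q) / ‖q.1‖) • q.1 - dt g (prof q) • (Complex.I • q.1)) (dt g (prof q))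

theorem metric_grad (g : ℝ × ℝ → ℝ) (q u : Heis n) :
    metric q (grad g q) u = fderiv ℝ g (prof q) (profDeriv q u) := by
  rw [metric_eq, grad, ofFrame_fst, theta_ofFrame, theta_eq, inner_sub_left, inner_smul_left,
    inner_smul_left, fderiv_eq_dr_dt, profDeriv_apply]
  simp only [conj_trivial]
  ring

theorem metric_grad_grad (g : ℝ × ℝ → ℝ) {q : Heis n} (hq : q.1 ≠ 0) :
    metric q (grad g q) (grad g q)
      = dr g (prof q) ^ 2 + ‖q.1‖ ^ 2 * dt g (prof q) ^ 2 + dt g (prof q) ^ 2 := by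
  have hr : ‖q.1‖ ≠ 0 := norm_ne_zero_iff.2 hq
  rw [metric_eq, grad, ofFrame_fst, theta_ofFrame]
  simp only [inner_sub_left, inner_sub_right, inner_smul_left, inner_smul_right,
    real_inner_self_eq_norm_sq, inner_I_smul_self, real_inner_comm (Complex.I • q.1) q.1,
    norm_smul, Complex.norm_I, one_mul, conj_trivial]
  field_simp
  ring

/-- Near `p`, a point off the axis, the set `S` is the zero set of `[z, t] ↦ g (|z|, t)` for a
regular function `g` of class `C²`. -/
structure IsProfile (S : Set (Heis n)) (g : ℝ × ℝ → ℝ) (p : Heis n) : Prop where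
  ne_zero : p.1 ≠ 0
  contDiffAt : ContDiffAt ℝ 2 g (prof p)
  regular : fderiv ℝ g (prof p) ≠ 0
  mem_iff : ∀ᶠ q in 𝓝 p, q ∈ S ↔ g (prof q) = 0

theorem IsProfile.eventually {S : Set (Heis n)} {g : ℝ × ℝ → ℝ} {p : Heis n}
    (h : IsProfile S g p) : ∀ᶠ q in 𝓝 p, IsProfile S g q := by
  have hπ : Filter.Tendsto prof (𝓝 p) (𝓝 (prof p)) := continuous_prof.continuousAt
  have h1 : ∀ᶠ q : Heis n in 𝓝 p, q.1 ≠ 0 := continuous_fst.continuousAt.eventually_ne h.ne_zero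
  have h2 := hπ.eventually (h.contDiffAt.eventually (by simp))
  have h3 := hπ.eventually
    ((h.contDiffAt.fderiv_right (m := 1) (by norm_num)).continuousAt.eventually_ne h.regular)
  filter_upwards [h1, h2, h3, h.mem_iff.eventually_nhds] with q a b c d using ⟨a, b, c, d⟩

theorem IsProfile.pos {S : Set (Heis n)} {g : ℝ × ℝ → ℝ} {p : Heis n} (h : IsProfile S g p) :
    0 < dr g (prof p) ^ 2 + ‖p.1‖ ^ 2 * dt g (prof p) ^ 2 := by
  have hr : 0 < ‖p.1‖ := norm_pos_iff.2 h.ne_zero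
  by_contra! h0
  have ha := sq_nonneg (dr g (prof p))
  have hb := mul_nonneg (sq_nonneg (‖p.1‖)) (sq_nonneg (dt g (prof p)))
  have h1 : dr g (prof p) ^ 2 = 0 := by linarith
  have h2 : ‖p.1‖ ^ 2 * dt g (prof p) ^ 2 = 0 := by linarith
  have h3 : dt g (prof p) = 0 := by
    rcases mul_eq_zero.1 h2 with h | h
    · exact absurd h (by positivity)
    · exact pow_eq_zero_iff two_ne_zero |>.1 h
  apply h.regular
  ext <;> simp [fderiv_eq_dr_dt, h3, pow_eq_zero_iff two_ne_zero |>.1 h1]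

theorem IsProfile.grad_pos {S : Set (Heis n)} {g : ℝ × ℝ → ℝ} {p : Heis n} (h : IsProfile S g p) :
    0 < metric p (grad g p) (grad g p) := by
  rw [metric_grad_grad g h.ne_zero]
  linarith [h.pos, sq_nonneg (dt g (prof p))]

theorem IsProfile.tangent_eq {S : Set (Heis n)} {g : ℝ × ℝ → ℝ} {p : Heis n} (h : IsProfile S g p)
    (hp : p ∈ S) : tangent S p = {u | metric p (grad g p) u = 0} := by
  have h1 : HasStrictFDerivAt (fun q => g (prof q))
      ((fderiv ℝ g (prof p)).comp (profDeriv p)) p := by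
    have h2 : ContDiffAt ℝ 2 (fun q : Heis n => g (prof q)) p :=
      h.contDiffAt.comp p (contDiffAt_prof h.ne_zero)
    have h3 := h2.hasStrictFDerivAt two_ne_zero
    have h4 : HasFDerivAt (fun q : Heis n => g (prof q)) _ p :=
      (h.contDiffAt.differentiableAt two_ne_zero).hasFDerivAt.comp p (hasFDerivAt_prof h.ne_zero)
    rwa [h4.fderiv] at h3
  rw [tangent_eq_ker hp h1 _ h.mem_iff]
  · simp only [metric_grad]
    rfl
  · intro h0
    have := h.grad_pos
    rw [metric_grad] at this
    exact this.ne' (DFunLike.congr_fun h0 (grad g p))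

theorem IsProfile.notMem_singularSet {S : Set (Heis n)} {g : ℝ × ℝ → ℝ} {p : Heis n}
    (h : IsProfile S g p) (hp : p ∈ S) : p ∉ singularSet S := by
  rintro ⟨-, hsing⟩
  rw [h.tangent_eq hp, horizontal_eq] at hsing
  have hr : ‖p.1‖ ≠ 0 := norm_ne_zero_iff.2 h.ne_zero
  have hu : ∀ w, fderiv ℝ g (prof p) (profDeriv p (ofFrame p w 0)) = 0 := by
    intro w
    rw [← metric_grad]
    have : ofFrame p w 0 ∈ {u | theta p u = 0} := theta_ofFrame p w 0
    rwa [← hsing] at this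
  have h1 := hu p.1
  have h2 := hu (Complex.I • p.1)
  simp only [fderiv_eq_dr_dt, profDeriv_apply, ofFrame_eq, imPair_eq_inner, inner_I_smul_self,
    real_inner_self_eq_norm_sq, real_inner_comm (Complex.I • p.1) p.1, norm_smul,
    Complex.norm_I, one_mul] at h1 h2
  field_simp at h1 h2
  simp at h1 h2
  have := h.pos
  simp_all

theorem tangent_orbit {S : Set (Heis n)} (hS : IsRotationallyInvariant S) {p : Heis n}
    (hp : p ∈ S) {w : EuclideanSpace ℂ (Fin n)} (hw : inner ℝ p.1 w = 0) (hn : ‖w‖ = ‖p.1‖) :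
    ((w, 0) : Heis n) ∈ tangent S p := by
  refine ⟨fun s => (Real.cos s • p.1 + Real.sin s • w, p.2), by simp, ?_, ?_⟩
  · refine Filter.Eventually.of_forall fun s => hS.mem_of_norm_eq (z := p.1) ?_ hp
    have : ‖p.1‖ ^ 2 = ‖Real.cos s • p.1 + Real.sin s • w‖ ^ 2 := by
      rw [norm_add_sq_real, inner_smul_left, inner_smul_right, hw, norm_smul, norm_smul, hn,
        mul_pow, mul_pow, Real.norm_eq_abs, Real.norm_eq_abs, sq_abs, sq_abs]
      simp
      linear_combination -‖p.1‖ ^ 2 * Real.cos_sq_add_sin_sq s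
    exact (pow_left_inj₀ (norm_nonneg _) (norm_nonneg _) two_ne_zero).1 this
  · have h1 := ((Real.hasDerivAt_cos 0).smul_const p.1).add ((Real.hasDerivAt_sin 0).smul_const w)
    have h2 := h1.prodMk (hasDerivAt_const (0 : ℝ) p.2)
    simpa using h2

/-- A rotationally invariant hypersurface has a profile function at each point off the axis. -/
theorem exists_isProfile {S : Set (Heis n)} (hS : IsRotationallyInvariant S)
    (hC : IsC2Hypersurface S) {p : Heis n} (hp : p ∈ S) (hp0 : p.1 ≠ 0) :
    ∃ g, IsProfile S g p := by
  obtain ⟨U, hU, hpU, f, hf, hf', hSU⟩ := hC p hp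
  have hr : ‖p.1‖ ≠ 0 := norm_ne_zero_iff.2 hp0
  let l : ℝ × ℝ →L[ℝ] Heis n :=
    ((ContinuousLinearMap.fst ℝ ℝ ℝ).smulRight (‖p.1‖⁻¹ • p.1)).prod (ContinuousLinearMap.snd ℝ ℝ ℝ)
  have hl : ∀ x, l x = (x.1 • ‖p.1‖⁻¹ • p.1, x.2) := fun x => rfl
  have hlp : l (prof p) = p := by
    rw [hl]
    ext1
    · simp [prof, smul_smul, hr]
    · rfl
  have hlnorm : ∀ q : Heis n, ‖(l (prof q)).1‖ = ‖q.1‖ := by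
    intro q
    rw [hl]
    simp [prof, norm_smul, hr]
  have hfp : ContDiffAt ℝ 2 f p := hf.contDiffAt (hU.mem_nhds hpU)
  have hfd : HasFDerivAt f (fderiv ℝ f p) (l (prof p)) := by
    rw [hlp]
    exact (hfp.differentiableAt two_ne_zero).hasFDerivAt
  have hfS : ∀ᶠ q in 𝓝 p, q ∈ S ↔ f q = 0 := by
    filter_upwards [hU.mem_nhds hpU] with q hq
    have : q ∈ S ∩ U ↔ q ∈ {q ∈ U | f q = 0} := by rw [hSU]
    simpa [hq] using this
  refine ⟨fun x => f (l x), hp0, ?_, ?_, ?_⟩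
  · refine ContDiffAt.comp (g := f) _ (by rwa [hlp]) l.contDiff.contDiffAt
  · have h1 : HasFDerivAt (fun x => f (l x)) ((fderiv ℝ f p).comp l) (prof p) :=
      hfd.comp _ l.hasFDerivAt
    rw [h1.fderiv]
    intro h0
    apply hf' p ⟨hp, hpU⟩
    have hperp : ∀ w, inner ℝ p.1 w = 0 → fderiv ℝ f p (w, 0) = 0 := by
      intro w hw
      by_cases hw0 : w = 0
      · rw [hw0]
        exact map_zero _
      have hw1 : ‖w‖ ≠ 0 := norm_ne_zero_iff.2 hw0
      have := tangent_subset_ker (hfp.differentiableAt two_ne_zero).hasFDerivAt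
        (hfS.mono fun q hq => hq.1)
        (tangent_orbit hS hp (w := (‖p.1‖ / ‖w‖) • w) (by rw [inner_smul_right, hw, mul_zero])
          (by rw [norm_smul]; simp [hw1]))
      have e : (((‖p.1‖ / ‖w‖) • w, 0) : Heis n) = (‖p.1‖ / ‖w‖) • (w, 0) := by simp
      rw [e, map_smul, smul_eq_mul] at this
      exact (mul_eq_zero.1 this).resolve_left (div_ne_zero hr hw1)
    have hz : fderiv ℝ f p (p.1, 0) = 0 := by
      have := DFunLike.congr_fun h0 (‖p.1‖, 0)
      rw [ContinuousLinearMap.comp_apply, hl] at this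
      simpa [smul_smul, hr] using this
    have ht : fderiv ℝ f p (0, 1) = 0 := by
      have := DFunLike.congr_fun h0 (0, 1)
      rw [ContinuousLinearMap.comp_apply, hl] at this
      simpa using this
    refine ContinuousLinearMap.ext fun u => ?_
    have e : u = (inner ℝ p.1 u.1 / ‖p.1‖ ^ 2) • ((p.1, 0) : Heis n)
        + (u.1 - (inner ℝ p.1 u.1 / ‖p.1‖ ^ 2) • p.1, 0) + u.2 • ((0, 1) : Heis n) := by
      ext1 <;> simp
    rw [e, map_add, map_add, map_smul, map_smul, hz, ht, hperp]
    · simp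
    · rw [inner_sub_right, inner_smul_right, real_inner_self_eq_norm_sq]
      field_simp
      ring
  · have hlt : Filter.Tendsto (fun q : Heis n => l (prof q)) (𝓝 p) (𝓝 p) := by
      have h := (l.continuous.comp continuous_prof).tendsto p
      rwa [Function.comp_apply, hlp] at h
    filter_upwards [hlt.eventually hfS] with q hq
    rw [← hq]
    exact ⟨fun h => hS.mem_of_norm_eq (hlnorm q).symm h, fun h => hS.mem_of_norm_eq (hlnorm q) h⟩

/-! ### The angle of the horizontal normal -/

/-- The cosine of the angle `ψ` that the horizontal normal of `{g = 0}` makes with the radial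
direction. -/
def profCos (g : ℝ × ℝ → ℝ) (x : ℝ × ℝ) : ℝ :=
  dr g x / √(dr g x ^ 2 + x.1 ^ 2 * dt g x ^ 2)

/-- The sine of the angle `ψ` that the horizontal normal of `{g = 0}` makes with the radial
direction. -/
def profSin (g : ℝ × ℝ → ℝ) (x : ℝ × ℝ) : ℝ :=
  -(x.1 * dt g x) / √(dr g x ^ 2 + x.1 ^ 2 * dt g x ^ 2)

theorem profCos_sq_add_profSin_sq {g : ℝ × ℝ → ℝ} {x : ℝ × ℝ}
    (h : 0 < dr g x ^ 2 + x.1 ^ 2 * dt g x ^ 2) : profCos g x ^ 2 + profSin g x ^ 2 = 1 := by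
  rw [profCos, profSin, div_pow, div_pow, Real.sq_sqrt h.le, ← add_div]
  rw [div_eq_one_iff_eq h.ne']
  ring

theorem differentiableAt_profCos_profSin {g : ℝ × ℝ → ℝ} {x : ℝ × ℝ} (hg : ContDiffAt ℝ 2 g x)
    (h : 0 < dr g x ^ 2 + x.1 ^ 2 * dt g x ^ 2) :
    DifferentiableAt ℝ (profCos g) x ∧ DifferentiableAt ℝ (profSin g) x := by
  have h1 : DifferentiableAt ℝ (fderiv ℝ g) x :=
    (hg.fderiv_right (m := 1) (by norm_num)).differentiableAt one_ne_zero
  have hA : DifferentiableAt ℝ (dr g) x := h1.clm_apply (differentiableAt_const _)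
  have hB : DifferentiableAt ℝ (dt g) x := h1.clm_apply (differentiableAt_const _)
  have hW : DifferentiableAt ℝ (fun x => √(dr g x ^ 2 + x.1 ^ 2 * dt g x ^ 2)) x :=
    ((hA.pow 2).add ((differentiableAt_fst.pow 2).mul (hB.pow 2))).sqrt h.ne'
  have hW0 : √(dr g x ^ 2 + x.1 ^ 2 * dt g x ^ 2) ≠ 0 := (Real.sqrt_pos.2 h).ne'
  have hC := hA.mul (hW.inv hW0)
  have hD := (differentiableAt_fst.mul hB).neg.mul (hW.inv hW0)
  exact ⟨hC, hD⟩

theorem IsProfile.eventually_pos {S : Set (Heis n)} {g : ℝ × ℝ → ℝ} {p : Heis n}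
    (h : IsProfile S g p) : ∀ᶠ x in 𝓝 (prof p), 0 < x.1 ∧ ContDiffAt ℝ 2 g x ∧
      0 < dr g x ^ 2 + x.1 ^ 2 * dt g x ^ 2 := by
  have h1 : ContinuousAt (fderiv ℝ g) (prof p) :=
    (h.contDiffAt.fderiv_right (m := 1) (by norm_num)).continuousAt
  have hA : ContinuousAt (dr g) (prof p) := h1.clm_apply continuousAt_const
  have hB : ContinuousAt (dt g) (prof p) := h1.clm_apply continuousAt_const
  have hW : ContinuousAt (fun x => dr g x ^ 2 + x.1 ^ 2 * dt g x ^ 2) (prof p) :=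
    (hA.pow 2).add ((continuousAt_fst.pow 2).mul (hB.pow 2))
  have hr : 0 < (prof p).1 := norm_pos_iff.2 h.ne_zero
  filter_upwards [continuousAt_fst.eventually_const_lt hr, h.contDiffAt.eventually (by simp),
    hW.eventually_const_lt h.pos] with x a b c using ⟨a, b, c⟩

/-- A profile function of `S` at `p` whose gradient points in the direction of the unit normal. -/
structure IsNormalProfile (S : Set (Heis n)) (N : Heis n → Heis n) (g : ℝ × ℝ → ℝ)
    (p : Heis n) : Prop extends IsProfile S g p where
  normal : ∀ᶠ q in 𝓝[S] p, N q = (√(metric q (grad g q) (grad g q)))⁻¹ • grad g q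

theorem IsNormalProfile.eventually {S : Set (Heis n)} {N : Heis n → Heis n} {g : ℝ × ℝ → ℝ}
    {p : Heis n} (h : IsNormalProfile S N g p) : ∀ᶠ q in 𝓝[S] p, IsNormalProfile S N g q := by
  filter_upwards [h.toIsProfile.eventually.filter_mono nhdsWithin_le_nhds,
    eventually_eventually_nhdsWithin.2 h.normal] with q a b using ⟨a, b⟩

theorem grad_neg (g : ℝ × ℝ → ℝ) (q : Heis n) : grad (fun x => -g x) q = -grad g q := by
  have h1 : dr (fun x => -g x) (prof q) = -dr g (prof q) := by simp [dr, fderiv_fun_neg]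
  have h2 : dt (fun x => -g x) (prof q) = -dt g (prof q) := by simp [dt, fderiv_fun_neg]
  apply ext_frame (p := q)
  · simp only [grad, ofFrame_fst, Prod.fst_neg, h1, h2]
    module
  · rw [← neg_one_smul ℝ (grad g q), theta_smul, grad, grad, theta_ofFrame, theta_ofFrame, h2]
    ring

theorem metric_neg_neg (p u : Heis n) : metric p (-u) (-u) = metric p u u := by
  rw [← inner_frameCoord, ← inner_frameCoord, map_neg, inner_neg_neg]

/-- Up to the sign of `g`, the normal is the normalized gradient of `g`: by continuity the sign
does not change near `p`. -/
theorem IsProfile.exists_isNormalProfile {S : Set (Heis n)} {g : ℝ × ℝ → ℝ} {p : Heis n}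
    (h : IsProfile S g p) (hp : p ∈ S) {N : Heis n → Heis n} (hN : IsUnitNormal S N) :
    ∃ g, IsNormalProfile S N g p := by
  have hpt : ∀ᶠ q in 𝓝[S] p, metric q (N q) (grad g q) ^ 2 = metric q (grad g q) (grad g q) ∧
      N q = (metric q (N q) (grad g q) / metric q (grad g q) (grad g q)) • grad g q := by
    filter_upwards [h.eventually.filter_mono nhdsWithin_le_nhds, self_mem_nhdsWithin] with q hq hqS
    obtain ⟨h1, h2⟩ := hN.2 q hqS
    rw [hq.tangent_eq hqS] at h2
    exact eq_smul_of_perp h1 hq.grad_pos h2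
  have hcont : ContinuousWithinAt (fun q => metric q (N q) (grad g q)) S p := by
    have h1 : ContinuousAt (fderiv ℝ g) (prof p) :=
      (h.contDiffAt.fderiv_right (m := 1) (by norm_num)).continuousAt
    have h2 : ContinuousAt (fun q : Heis n => fderiv ℝ g (prof q)) p :=
      ContinuousAt.comp (f := prof) h1 continuous_prof.continuousAt
    have h3 : ContinuousWithinAt (fun q => profDeriv q (N q)) S p := by
      simp only [profDeriv_apply]
      have hNp := hN.1 p hp
      have hfst : ContinuousWithinAt (fun q : Heis n => q.1) S p :=
        continuous_fst.continuousWithinAt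
      exact ((hfst.norm.inv₀ (norm_ne_zero_iff.2 h.ne_zero)).mul (hfst.inner hNp.fst)).prodMk
        hNp.snd
    refine (h2.continuousWithinAt.clm_apply h3).congr (fun q _ => ?_) ?_ <;>
    rw [metric_comm, metric_grad]
  have hp2 := hpt.self_of_nhdsWithin hp
  have hne : metric p (N p) (grad g p) ≠ 0 := by
    intro h0
    rw [h0] at hp2
    linarith [hp2.1, h.grad_pos]
  rcases hne.lt_or_gt with hlt | hgt
  · refine ⟨fun x => -g x, ⟨h.ne_zero, h.contDiffAt.neg, ?_, by simpa using h.mem_iff⟩, ?_⟩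
    · simpa [fderiv_fun_neg] using h.regular
    · filter_upwards [hpt, hcont.eventually_lt_const hlt] with q h1 h2
      rw [grad_neg, metric_neg_neg, ← h1.1, Real.sqrt_sq_eq_abs, abs_of_neg h2]
      conv_lhs => rw [h1.2, ← h1.1]
      rw [smul_neg, ← neg_smul]
      congr 1
      field_simp
  · refine ⟨g, h, ?_⟩
    filter_upwards [hpt, hcont.eventually_const_lt hgt] with q h1 h2
    rw [← h1.1, Real.sqrt_sq_eq_abs, abs_of_pos h2]
    conv_lhs => rw [h1.2, ← h1.1]
    congr 1
    field_simp

theorem horizontalNormal_eq {N : Heis n → Heis n} {g : ℝ × ℝ → ℝ} {q : Heis n} (hq : q.1 ≠ 0)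
    (hpos : 0 < dr g (prof q) ^ 2 + ‖q.1‖ ^ 2 * dt g (prof q) ^ 2)
    (hN : N q = (√(metric q (grad g q) (grad g q)))⁻¹ • grad g q) :
    horizontalNormal N q = radialField (profCos g) (profSin g) q := by
  have hr : ‖q.1‖ ≠ 0 := norm_ne_zero_iff.2 hq
  have hG : 0 < metric q (grad g q) (grad g q) := by
    rw [metric_grad_grad g hq]
    linarith [sq_nonneg (dt g (prof q))]
  set κ := (√(metric q (grad g q) (grad g q)))⁻¹ with hκ
  have hκ0 : 0 < κ := inv_pos.2 (Real.sqrt_pos.2 hG)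
  have hθ : theta q (hproj q (N q)) = 0 := by
    rw [hproj, sub_eq_add_neg, ← neg_smul, theta_add, theta_smul, theta_T]
    ring
  have h1 : (hproj q (N q)).1 = κ • ((dr g (prof q) / ‖q.1‖) • q.1
      - dt g (prof q) • (Complex.I • q.1)) := by
    rw [hN]
    simp [hproj, T, grad, ofFrame_fst]
  have h2 : metric q (hproj q (N q)) (hproj q (N q))
      = κ ^ 2 * (dr g (prof q) ^ 2 + ‖q.1‖ ^ 2 * dt g (prof q) ^ 2) := by
    rw [metric_eq, hθ, h1]
    simp only [inner_sub_left, inner_sub_right, inner_smul_left, inner_smul_right,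
      real_inner_self_eq_norm_sq, inner_I_smul_self, real_inner_comm (Complex.I • q.1) q.1,
      norm_smul, Complex.norm_I, one_mul, conj_trivial]
    field_simp
    ring
  have hW := Real.sqrt_pos.2 hpos
  apply ext_frame (p := q)
  · rw [horizontalNormal, h2, Prod.smul_fst, h1, Real.sqrt_mul (sq_nonneg _), Real.sqrt_sq hκ0.le,
      radialField_fst, profCos, profSin]
    simp only [prof] at hW ⊢
    rw [smul_smul, smul_sub, smul_smul, smul_smul, sub_eq_add_neg, ← neg_smul]
    congr 2 <;> field_simp
  · rw [theta_radialField, horizontalNormal, theta_smul, hθ, mul_zero]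

/-- The radial component of the horizontal unit normal. -/
def nuCos (N : Heis n → Heis n) (q : Heis n) : ℝ := inner ℝ q.1 (horizontalNormal N q).1 / ‖q.1‖

/-- The component of the horizontal unit normal in the direction of `iz`. -/
def nuSin (N : Heis n → Heis n) (q : Heis n) : ℝ :=
  inner ℝ (Complex.I • q.1) (horizontalNormal N q).1 / ‖q.1‖

theorem IsNormalProfile.nu_eq {S : Set (Heis n)} {N : Heis n → Heis n} {g : ℝ × ℝ → ℝ}
    {p : Heis n} (h : IsNormalProfile S N g p) (hp : p ∈ S) :
    nuCos N p = profCos g (prof p) ∧ nuSin N p = profSin g (prof p) := by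
  have hr : ‖p.1‖ ≠ 0 := norm_ne_zero_iff.2 h.ne_zero
  rw [nuCos, nuSin, horizontalNormal_eq h.ne_zero h.pos (h.normal.self_of_nhdsWithin hp),
    radialField_fst]
  simp only [inner_add_right, inner_smul_right,
    real_inner_self_eq_norm_sq, inner_I_smul_self, real_inner_comm (Complex.I • p.1) p.1,
    norm_smul, Complex.norm_I, one_mul]
  constructor <;> field_simp <;> ring

theorem IsNormalProfile.eventually_nu_eq {S : Set (Heis n)} {N : Heis n → Heis n} {g : ℝ × ℝ → ℝ}
    {p : Heis n} (h : IsNormalProfile S N g p) :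
    ∀ᶠ q in 𝓝[S] p, nuCos N q = profCos g (prof q) ∧ nuSin N q = profSin g (prof q) := by
  filter_upwards [h.eventually, self_mem_nhdsWithin] with q hq hqS using hq.nu_eq hqS

/-- The equation of constant mean curvature for the profile curve: along the tangent field
`Z = (sin ψ, r cos ψ)` the angle satisfies `Z ψ = (2n - 1) cos ψ / r + 2 n h`. -/
theorem IsNormalProfile.angle_deriv {S : Set (Heis n)} {N : Heis n → Heis n} {g : ℝ × ℝ → ℝ}
    {p : Heis n} (h : IsNormalProfile S N g p) (hp : p ∈ S) (hN : IsUnitNormal S N) {H : ℝ}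
    (hd : HasDivAlong S (horizontalNormal N) p (-2 * n * H)) :
    fderiv ℝ (profSin g) (prof p) (profSin g (prof p), ‖p.1‖ * profCos g (prof p))
      = profCos g (prof p) * ((2 * n - 1) * profCos g (prof p) / ‖p.1‖ + 2 * n * H) ∧
    fderiv ℝ (profCos g) (prof p) (profSin g (prof p), ‖p.1‖ * profCos g (prof p))
      = -(profSin g (prof p) * ((2 * n - 1) * profCos g (prof p) / ‖p.1‖ + 2 * n * H)) := by
  obtain ⟨hc, hs⟩ := differentiableAt_profCos_profSin h.contDiffAt h.pos
  have hcs : ∀ᶠ x in 𝓝 (prof p), profCos g x ^ 2 + profSin g x ^ 2 = 1 :=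
    h.eventually_pos.mono fun x hx => profCos_sq_add_profSin_sq hx.2.2
  have hT : tangent S p = {u | metric p (N p) u = 0} := by
    have hκ : √(metric p (grad g p) (grad g p)) ≠ 0 := (Real.sqrt_pos.2 h.grad_pos).ne'
    rw [h.tangent_eq hp, h.normal.self_of_nhdsWithin hp]
    ext u
    rw [Set.mem_ofPred_eq, Set.mem_ofPred_eq, ← inner_frameCoord, ← inner_frameCoord, map_smul,
      inner_smul_left]
    simp [hκ]
  have hν : ∀ᶠ q in 𝓝[S] p, horizontalNormal N q = radialField (profCos g) (profSin g) q := by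
    filter_upwards [h.eventually, self_mem_nhdsWithin] with q hq hqS using
      horizontalNormal_eq hq.ne_zero hq.pos (hq.normal.self_of_nhdsWithin hqS)
  have key := (hasDivAlong_iff hp h.ne_zero hc hs hcs hν (hN.2 p hp).1 hT _).1 hd
  have hcs' : ∀ v, profCos g (prof p) * fderiv ℝ (profCos g) (prof p) v
      + profSin g (prof p) * fderiv ℝ (profSin g) (prof p) v = 0 := by
    intro v
    have h1 := (hc.hasFDerivAt.fun_mul hc.hasFDerivAt).fun_add
      (hs.hasFDerivAt.fun_mul hs.hasFDerivAt)
    have h2 : HasFDerivAt (fun x => profCos g x * profCos g x + profSin g x * profSin g x)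
        (0 : ℝ × ℝ →L[ℝ] ℝ) (prof p) :=
      (hasFDerivAt_const (1 : ℝ) (prof p)).congr_of_eventuallyEq
        (hcs.mono fun x hx => by rw [← hx]; ring)
    have := DFunLike.congr_fun (h1.unique h2) v
    simp at this
    linarith
  have h0 := hcs' (profSin g (prof p), ‖p.1‖ * profCos g (prof p))
  have h1 := hcs.self_of_nhds
  set c := profCos g (prof p)
  set s := profSin g (prof p)
  set c' := fderiv ℝ (profCos g) (prof p) (s, ‖p.1‖ * c)
  set s' := fderiv ℝ (profSin g) (prof p) (s, ‖p.1‖ * c)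
  have e : (2 * n - 1) * c / ‖p.1‖ + 2 * n * H = c * s' - s * c' := by linarith
  rw [e]
  constructor
  · linear_combination -s' * h1 + s * h0
  · linear_combination -c' * h1 + c * h0

/-! ### Functions of the profile -/

theorem IsProfile.eventually_of_eventually_mem {S : Set (Heis n)} {g : ℝ × ℝ → ℝ} {p : Heis n}
    (h : IsProfile S g p) {Q : ℝ × ℝ → Prop} (hQ : ∀ᶠ q in 𝓝[S] p, Q (prof q)) :
    ∀ᶠ x in 𝓝 (prof p), g x = 0 → Q x := by
  have hr : ‖p.1‖ ≠ 0 := norm_ne_zero_iff.2 h.ne_zero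
  let l : ℝ × ℝ → Heis n := fun x => ((x.1 / ‖p.1‖) • p.1, x.2)
  have hl : Filter.Tendsto l (𝓝 (prof p)) (𝓝 p) := by
    have hcont : Continuous l := by fun_prop
    have : l (prof p) = p := by
      ext1
      · simp [l, prof, hr]
      · rfl
    simpa only [this] using hcont.tendsto (prof p)
  filter_upwards [h.eventually_pos, hl.eventually h.mem_iff,
    hl.eventually (eventually_nhdsWithin_iff.1 hQ)] with x h1 h2 h3 h4
  have h5 : prof (l x) = x := by
    ext1
    · simp [prof, l, norm_smul, hr, abs_of_pos h1.1]
    · rfl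
  rw [h5] at h2 h3
  exact h3 (h2.2 h4)

/-- A function of `(|z|, t)` whose derivative along `Z` vanishes on `S` is locally constant
on `S`. -/
theorem IsProfile.eventually_eq {S : Set (Heis n)} {g : ℝ × ℝ → ℝ} {p : Heis n}
    (h : IsProfile S g p) (hp : p ∈ S) {F : Heis n → ℝ} {Ψ : ℝ × ℝ → ℝ}
    (hF : ∀ᶠ q in 𝓝[S] p, F q = Ψ (prof q))
    (hΨ : ∀ᶠ q in 𝓝[S] p,
      fderiv ℝ Ψ (prof q) (profSin g (prof q), ‖q.1‖ * profCos g (prof q)) = 0)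
    (hΨd : ∀ᶠ x in 𝓝 (prof p), DifferentiableAt ℝ Ψ x) : ∀ᶠ q in 𝓝[S] p, F q = F p := by
  have hg0 : g (prof p) = 0 := h.mem_iff.self_of_nhds.1 hp
  have hker : ∀ᶠ x in 𝓝 (prof p), g x = 0 →
      ∀ v, fderiv ℝ g x v = 0 → fderiv ℝ Ψ x v = 0 := by
    have hZ := h.eventually_of_eventually_mem (Q := fun x =>
      fderiv ℝ Ψ x (profSin g x, x.1 * profCos g x) = 0) hΨ
    filter_upwards [hZ, h.eventually_pos] with x h1 h23 h4 v hv
    obtain ⟨h2, -, h3⟩ := h23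
    have h5 := h1 h4
    rw [fderiv_eq_dr_dt] at hv h5 ⊢
    have hW := Real.sqrt_pos.2 h3
    rw [profSin, profCos] at h5
    field_simp at h5
    rw [mul_zero] at h5
    have h5 := (mul_eq_zero.1 h5).resolve_left h2.ne'
    have e1 : (v.1 * dr Ψ x + v.2 * dt Ψ x) * dr g x = 0 := by
      linear_combination dr Ψ x * hv + v.2 * h5
    have e2 : (v.1 * dr Ψ x + v.2 * dt Ψ x) * dt g x = 0 := by
      linear_combination dt Ψ x * hv - v.1 * h5
    by_contra hne
    have e3 := (mul_eq_zero.1 e1).resolve_left hne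
    have e4 := (mul_eq_zero.1 e2).resolve_left hne
    rw [e3, e4] at h3
    simp at h3
  have key := (h.contDiffAt.of_le one_le_two).eventually_eq_of_ker_fderiv_le h.regular hΨd
    (by rwa [hg0])
  rw [hg0] at key
  filter_upwards [hF, (continuous_prof.continuousAt.eventually key).filter_mono nhdsWithin_le_nhds,
    h.mem_iff.filter_mono nhdsWithin_le_nhds, self_mem_nhdsWithin] with q h1 h2 h3 h4
  rw [h1, h2 (h3.1 h4), hF.self_of_nhdsWithin hp]

/-- At an extremum on `S` of a function of `(|z|, t)` the derivative along `Z` vanishes. -/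
theorem IsProfile.fderiv_eq_zero_of_isExtrOn {S : Set (Heis n)} {g : ℝ × ℝ → ℝ} {p : Heis n}
    (h : IsProfile S g p) (hp : p ∈ S) {F : Heis n → ℝ} {Ψ : ℝ × ℝ → ℝ}
    (hF : ∀ᶠ q in 𝓝[S] p, F q = Ψ (prof q)) (hΨ : DifferentiableAt ℝ Ψ (prof p))
    (hext : IsExtrOn F S p) :
    fderiv ℝ Ψ (prof p) (profSin g (prof p), ‖p.1‖ * profCos g (prof p)) = 0 := by
  have hr : ‖p.1‖ ≠ 0 := norm_ne_zero_iff.2 h.ne_zero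
  let u : Heis n := ((profSin g (prof p) / ‖p.1‖) • p.1, ‖p.1‖ * profCos g (prof p))
  have hu : profDeriv p u = (profSin g (prof p), ‖p.1‖ * profCos g (prof p)) := by
    rw [profDeriv_apply]
    simp only [u, inner_smul_right, real_inner_self_eq_norm_sq]
    congr 1
    field_simp
  have hut : u ∈ tangent S p := by
    rw [h.tangent_eq hp, Set.mem_ofPred_eq, metric_grad, hu, fderiv_eq_dr_dt, profSin, profCos]
    simp only [prof]
    ring
  obtain ⟨c, hc0, hcS, hcu⟩ := hut
  have ht : Filter.Tendsto c (𝓝 0) (𝓝[S] p) := by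
    refine tendsto_nhdsWithin_iff.2 ⟨?_, hcS⟩
    have := hcu.continuousAt.tendsto
    rwa [hc0] at this
  have h1 : HasDerivAt (fun s => Ψ (prof (c s)))
      (fderiv ℝ Ψ (prof p) (profDeriv p u)) 0 := by
    have h2 : HasFDerivAt (fun q => Ψ (prof q))
        ((fderiv ℝ Ψ (prof p)).comp (profDeriv p)) (c 0) := by
      rw [hc0]
      exact hΨ.hasFDerivAt.comp p (hasFDerivAt_prof h.ne_zero)
    exact h2.comp_hasDerivAt 0 hcu
  have h3 : (fun s => F (c s)) =ᶠ[𝓝 0] fun s => Ψ (prof (c s)) := ht.eventually hF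
  have h4 : IsLocalExtr (fun s => F (c s)) 0 := by
    rcases hext with hmin | hmax
    · exact Or.inl (hcS.mono fun s hs => by simpa [hc0] using hmin hs)
    · exact Or.inr (hcS.mono fun s hs => by simpa [hc0] using hmax hs)
  rw [← hu]
  exact h4.hasDerivAt_eq_zero (h1.congr_of_eventuallyEq h3)

/-! ### Points on the axis -/

theorem tangent_axis_I_smul {S : Set (Heis n)} (hS : IsRotationallyInvariant S) {p : Heis n}
    (hp0 : p.1 = 0) {u : Heis n} (hu : u ∈ tangent S p) :
    ((Complex.I • u.1, u.2) : Heis n) ∈ tangent S p := by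
  obtain ⟨c, hc0, hcS, hcu⟩ := hu
  refine ⟨fun s => (Complex.I • (c s).1, (c s).2), ?_, ?_, ?_⟩
  · simp only [hc0, hp0]
    ext1
    · simp [hp0]
    · rfl
  · exact hcS.mono fun s hs => hS.mem_of_norm_eq (z := (c s).1) (by simp [norm_smul]) hs
  · exact ((mulI (n := n)).hasFDerivAt.comp_hasDerivAt 0
      (hcu.hasFDerivAt.fst.hasDerivAt)).prodMk (hcu.hasFDerivAt.snd.hasDerivAt) |>.congr_deriv
      (by simp [mulI_apply])

/-- At a point on the axis the tangent hyperplane of a rotationally invariant hypersurface is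
horizontal, because the normal direction is fixed by the rotations; moreover the point is isolated
among the points of the hypersurface on the axis. -/
theorem axis_point {S : Set (Heis n)} (hS : IsRotationallyInvariant S)
    (hC : IsC2Hypersurface S) {p : Heis n} (hp : p ∈ S) (hp0 : p.1 = 0) :
    tangent S p = {u | u.2 = 0} ∧ ∀ᶠ q in 𝓝 p, q ∈ S → q.1 = 0 → q = p := by
  obtain ⟨U, hU, hpU, f, hf, hf', hSU⟩ := hC p hp
  have hfp : ContDiffAt ℝ 2 f p := hf.contDiffAt (hU.mem_nhds hpU)
  have hfs : HasStrictFDerivAt f (fderiv ℝ f p) p := hfp.hasStrictFDerivAt two_ne_zero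
  have hfS : ∀ᶠ q in 𝓝 p, q ∈ S ↔ f q = 0 := by
    filter_upwards [hU.mem_nhds hpU] with q hq
    have : q ∈ S ∩ U ↔ q ∈ {q ∈ U | f q = 0} := by rw [hSU]
    simpa [hq] using this
  have hne := hf' p ⟨hp, hpU⟩
  have htan := tangent_eq_ker hp hfs hne hfS
  have hw : ∀ w, fderiv ℝ f p (w, 0) = 0 := by
    let φ : EuclideanSpace ℂ (Fin n) →L[ℝ] ℝ :=
      (fderiv ℝ f p).comp (ContinuousLinearMap.inl ℝ _ _)
    set a := (InnerProductSpace.toDual ℝ (EuclideanSpace ℂ (Fin n))).symm φ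
    have ha : ∀ w, fderiv ℝ f p (w, 0) = inner ℝ a w := fun w => by
      rw [InnerProductSpace.toDual_symm_apply]
      rfl
    have h1 : ((Complex.I • a, 0) : Heis n) ∈ tangent S p := by
      rw [htan, Set.mem_ofPred_eq, ha, real_inner_comm, inner_I_smul_self]
    have h2 := tangent_axis_I_smul hS hp0 h1
    rw [htan, Set.mem_ofPred_eq, ha, smul_smul, Complex.I_mul_I, neg_one_smul,
      inner_neg_right, neg_eq_zero, inner_self_eq_zero] at h2
    intro w
    rw [ha, h2, inner_zero_left]
  have hval : ∀ u : Heis n, fderiv ℝ f p u = u.2 * fderiv ℝ f p (0, 1) := by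
    intro u
    have : u = (u.1, 0) + u.2 • ((0, 1) : Heis n) := by ext1 <;> simp
    conv_lhs => rw [this]
    rw [map_add, hw, map_smul, zero_add, smul_eq_mul]
  have hb : fderiv ℝ f p (0, 1) ≠ 0 := by
    intro hb
    apply hne
    refine ContinuousLinearMap.ext fun u => ?_
    rw [hval, hb, mul_zero, _root_.zero_apply]
  refine ⟨?_, ?_⟩
  · rw [htan]
    ext u
    simp [hval u, hb]
  · have hline : HasDerivAt (fun t : ℝ => f ((0, t) : Heis n)) (fderiv ℝ f p (0, 1)) p.2 := by
      have h1 : HasFDerivAt f (fderiv ℝ f p) ((0, p.2) : Heis n) := by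
        have : ((0, p.2) : Heis n) = p := by rw [← hp0]
        rw [this]
        exact hfs.hasFDerivAt
      exact h1.comp_hasDerivAt p.2 ((hasDerivAt_const p.2 0).prodMk (hasDerivAt_id p.2))
    have h2 := eventually_nhdsWithin_iff.1 (hline.eventually_ne (c := 0) hb)
    filter_upwards [hfS, continuous_snd.continuousAt.eventually h2] with q h3 h4 h5 h6
    by_contra hqp
    apply h4 _
    · have : ((0, q.2) : Heis n) = q := by rw [← h6]
      rw [this]
      exact h3.1 h5
    · intro h7
      exact hqp (Prod.ext (by rw [h6, hp0]) h7)

theorem countable_axis {S : Set (Heis n)} (hS : IsRotationallyInvariant S)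
    (hC : IsC2Hypersurface S) : {p | p ∈ S ∧ p.1 = 0}.Countable := by
  have h : ∀ p ∈ {p | p ∈ S ∧ p.1 = 0}, {p} ∈ 𝓝[{p | p ∈ S ∧ p.1 = 0}] p := fun p hp => by
    have h1 := (axis_point hS hC hp.1 hp.2).2.filter_mono
      (nhdsWithin_le_nhds (s := {p | p ∈ S ∧ p.1 = 0}))
    filter_upwards [h1, self_mem_nhdsWithin] with q h2 h3 using h2 h3.1 h3.2
  obtain ⟨t, -, htc, ht⟩ := TopologicalSpace.countable_cover_nhdsWithin h
  refine htc.mono fun p hp => ?_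
  obtain ⟨q, hq, hpq⟩ := Set.mem_iUnion₂.1 (ht hp)
  rwa [Set.mem_singleton_iff.1 hpq]

theorem theta_normal_axis {S : Set (Heis n)} (hS : IsRotationallyInvariant S)
    (hC : IsC2Hypersurface S) {p : Heis n} (hp : p ∈ S) (hp0 : p.1 = 0) {N : Heis n → Heis n}
    (hN : IsUnitNormal S N) : theta p (N p) ^ 2 = 1 := by
  obtain ⟨h1, h2⟩ := hN.2 p hp
  have h3 := h2 ((N p).1, 0) (by rw [(axis_point hS hC hp hp0).1]; rfl)
  rw [metric_eq] at h1 h3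
  have h4 : theta p ((N p).1, 0) = 0 := by simp [theta_eq, hp0]
  rw [h4, mul_zero, add_zero] at h3
  rw [h3] at h1
  linarith

theorem exists_off_axis (hn : 1 ≤ n) {S : Set (Heis n)} (hS : IsRotationallyInvariant S)
    (hC : IsC2Hypersurface S) (hne : S.Nonempty) : ∃ p ∈ S, p.1 ≠ 0 := by
  by_contra! h
  obtain ⟨p, hp⟩ := hne
  let w : EuclideanSpace ℂ (Fin n) := EuclideanSpace.single ⟨0, hn⟩ 1
  have hw : ((w, 0) : Heis n) ∈ tangent S p := by
    rw [(axis_point hS hC hp (h p hp)).1]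
    rfl
  obtain ⟨c, -, hcS, hcu⟩ := hw
  have h1 : HasDerivAt (fun s => (c s).1) w 0 :=
    hcu.hasFDerivAt.fst.hasDerivAt.congr_deriv (by simp)
  have h2 : HasDerivAt (fun s => (c s).1) 0 0 :=
    (hasDerivAt_const (0 : ℝ) (0 : EuclideanSpace ℂ (Fin n))).congr_of_eventuallyEq
      (hcS.mono fun s hs => h _ hs)
  have h3 := congrFun (congrArg (fun v : EuclideanSpace ℂ (Fin n) => v.ofLp) (h1.unique h2)) ⟨0, hn⟩
  simp [w] at h3

/-! ### The profile of the spheres -/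

/-- The height of the point at angle `φ` on the profile of a sphere, up to the factor `1/(2H²)`. -/
def arcHeight (φ : ℝ) : ℝ := φ + Real.sin φ * Real.cos φ

theorem strictMono_arcHeight : StrictMono arcHeight := by
  intro a b hab
  have h1 : arcHeight b - arcHeight a = (b - a) + Real.sin (b - a) * Real.cos (b + a) := by
    rw [arcHeight, arcHeight, Real.sin_sub, Real.cos_add]
    linear_combination (Real.sin a * Real.cos a) * Real.sin_sq_add_cos_sq b
      - (Real.sin b * Real.cos b) * Real.sin_sq_add_cos_sq a
  have h2 : |Real.sin (b - a)| < b - a := by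
    have := Real.abs_sin_lt_abs (x := b - a) (by linarith)
    rwa [abs_of_pos (by linarith : 0 < b - a)] at this
  have h3 : |Real.sin (b - a) * Real.cos (b + a)| ≤ |Real.sin (b - a)| := by
    rw [abs_mul]
    exact mul_le_of_le_one_right (abs_nonneg _) (Real.abs_cos_le_one _)
  have h4 := neg_abs_le (Real.sin (b - a) * Real.cos (b + a))
  linarith

theorem mem_translate_sphere {H : ℝ} (hH : 0 < H) (t₀ : ℝ) (p : Heis n) :
    p ∈ hmul ((0, t₀) : Heis n) '' sphere n H ↔
      ∃ φ ∈ Set.Icc (-(Real.pi / 2)) (Real.pi / 2), H * ‖p.1‖ = Real.cos φ ∧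
        2 * H ^ 2 * (p.2 - t₀) = arcHeight φ := by
  have hH0 : H ≠ 0 := hH.ne'
  have htr : p ∈ hmul ((0, t₀) : Heis n) '' sphere n H ↔
      ((p.1, p.2 - t₀) : Heis n) ∈ sphere n H := by
    constructor
    · rintro ⟨q, hq, rfl⟩
      have : ((hmul ((0, t₀) : Heis n) q).1, (hmul ((0, t₀) : Heis n) q).2 - t₀) = q := by
        ext1 <;> simp [hmul, imPair]
      rwa [this]
    · intro h
      refine ⟨_, h, ?_⟩
      ext1 <;> simp [hmul, imPair]
  rw [htr, sphere, Set.mem_ofPred_eq]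
  simp only
  have hx0 : 0 ≤ H * ‖p.1‖ := by positivity
  constructor
  · rintro ⟨h1, h2⟩
    have hx1 : H * ‖p.1‖ ≤ 1 := by
      rw [le_div_iff₀ hH] at h1
      linarith
    have ha0 := Real.arccos_nonneg (H * ‖p.1‖)
    have ha1 : Real.arccos (H * ‖p.1‖) ≤ Real.pi / 2 := Real.arccos_le_pi_div_two.2 hx0
    have hcos : Real.cos (Real.arccos (H * ‖p.1‖)) = H * ‖p.1‖ :=
      Real.cos_arccos (by linarith) hx1
    have hpi := Real.pi_pos
    rcases h2 with h2 | h2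
    · refine ⟨Real.arccos (H * ‖p.1‖), ⟨by linarith, ha1⟩, hcos.symm, ?_⟩
      rw [arcHeight, hcos, Real.sin_arccos, h2, mul_pow]
      field_simp
      ring
    · refine ⟨-Real.arccos (H * ‖p.1‖), ⟨by linarith, by linarith⟩, ?_, ?_⟩
      · rw [Real.cos_neg, hcos]
      · rw [arcHeight, Real.cos_neg, Real.sin_neg, hcos, Real.sin_arccos, h2, mul_pow]
        field_simp
        ring
  · rintro ⟨φ, ⟨hφ1, hφ2⟩, h1, h2⟩
    refine ⟨?_, ?_⟩
    · rw [le_div_iff₀ hH, mul_comm, h1]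
      exact Real.cos_le_one _
    have hsq : H ^ 2 * ‖p.1‖ ^ 2 = Real.cos φ ^ 2 := by rw [← h1, mul_pow]
    have hs : 1 - Real.cos φ ^ 2 = Real.sin φ ^ 2 := by linarith [Real.sin_sq_add_cos_sq φ]
    have hpi := Real.pi_pos
    rw [h1, hsq, hs, Real.sqrt_sq_eq_abs]
    have h3 : p.2 - t₀ = 1 / (2 * H ^ 2) * arcHeight φ := by
      rw [← h2]
      field_simp
    rcases le_total 0 φ with h0 | h0
    · left
      rw [Real.arccos_cos h0 (by linarith),
        abs_of_nonneg (Real.sin_nonneg_of_nonneg_of_le_pi h0 (by linarith))]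
      rw [h3, arcHeight]
      ring
    · right
      rw [← Real.cos_neg, Real.arccos_cos (by linarith) (by linarith), Real.cos_neg,
        abs_of_nonpos (Real.sin_nonpos_of_nonpos_of_neg_pi_le h0 (by linarith))]
      rw [h3, arcHeight]
      ring

/-! ### Uniqueness -/

/-- A rotationally invariant hypersurface of constant mean curvature `h` with respect to the unit
normal `N`. -/
structure IsRotationalCMC (S : Set (Heis n)) (N : Heis n → Heis n) (h : ℝ) : Prop where
  invariant : IsRotationallyInvariant S
  hypersurface : IsC2Hypersurface S
  unitNormal : IsUnitNormal S N
  hasDiv : ∀ p ∈ S \ singularSet S, HasDivAlong S (horizontalNormal N) p (-2 * n * h)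

namespace IsRotationalCMC

variable {S : Set (Heis n)} {N : Heis n → Heis n} {h : ℝ}

theorem exists_profile (hS : IsRotationalCMC S N h) {p : Heis n} (hp : p ∈ S) (hp0 : p.1 ≠ 0) :
    ∃ g, IsNormalProfile S N g p := by
  obtain ⟨g, hg⟩ := exists_isProfile hS.invariant hS.hypersurface hp hp0
  exact hg.exists_isNormalProfile hp hS.unitNormal

theorem angle_deriv (hS : IsRotationalCMC S N h) {p : Heis n} (hp : p ∈ S) {g : ℝ × ℝ → ℝ}
    (hg : IsNormalProfile S N g p) :
    fderiv ℝ (profSin g) (prof p) (profSin g (prof p), ‖p.1‖ * profCos g (prof p))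
      = profCos g (prof p) * ((2 * n - 1) * profCos g (prof p) / ‖p.1‖ + 2 * n * h) ∧
    fderiv ℝ (profCos g) (prof p) (profSin g (prof p), ‖p.1‖ * profCos g (prof p))
      = -(profSin g (prof p) * ((2 * n - 1) * profCos g (prof p) / ‖p.1‖ + 2 * n * h)) :=
  hg.angle_deriv hp hS.unitNormal (hS.hasDiv p ⟨hp, hg.notMem_singularSet hp⟩)

theorem nu_sq (hS : IsRotationalCMC S N h) {p : Heis n} (hp : p ∈ S) (hp0 : p.1 ≠ 0) :
    nuCos N p ^ 2 + nuSin N p ^ 2 = 1 := by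
  obtain ⟨g, hg⟩ := hS.exists_profile hp hp0
  rw [(hg.nu_eq hp).1, (hg.nu_eq hp).2]
  exact profCos_sq_add_profSin_sq hg.pos

theorem continuousWithinAt_nu (hS : IsRotationalCMC S N h) {p : Heis n} (hp : p ∈ S)
    (hp0 : p.1 ≠ 0) :
    ContinuousWithinAt (nuCos N) S p ∧ ContinuousWithinAt (nuSin N) S p := by
  obtain ⟨g, hg⟩ := hS.exists_profile hp hp0
  obtain ⟨hc, hs⟩ := differentiableAt_profCos_profSin hg.contDiffAt hg.pos
  have hc' := (ContinuousAt.comp (f := prof) hc.continuousAt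
    continuous_prof.continuousAt).continuousWithinAt (s := S)
  have hs' := (ContinuousAt.comp (f := prof) hs.continuousAt
    continuous_prof.continuousAt).continuousWithinAt (s := S)
  exact ⟨hc'.congr_of_eventuallyEq (hg.eventually_nu_eq.mono fun q hq => hq.1) (hg.nu_eq hp).1,
    hs'.congr_of_eventuallyEq (hg.eventually_nu_eq.mono fun q hq => hq.2) (hg.nu_eq hp).2⟩

/-- Functions that are continuous on `S` off the axis and bounded become continuous on `S` after
multiplication by a positive power of the distance to the axis. -/
theorem _root_.Heis.continuousOn_norm_pow_mul {κ : Heis n → ℝ} (hb : ∀ q ∈ S, |κ q| ≤ 1)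
    (hc : ∀ p ∈ S, p.1 ≠ 0 → ContinuousWithinAt κ S p) {k : ℕ} (hk : k ≠ 0) :
    ContinuousOn (fun q => ‖q.1‖ ^ k * κ q) S := by
  intro p hp
  have hn : Continuous fun q : Heis n => ‖q.1‖ ^ k := by fun_prop
  by_cases hp0 : p.1 = 0
  · have h0 : ‖p.1‖ ^ k * κ p = 0 := by simp [hp0, hk]
    rw [ContinuousWithinAt, h0]
    have hlim : Filter.Tendsto (fun q : Heis n => ‖q.1‖ ^ k) (𝓝[S] p) (𝓝 0) := by
      have := hn.continuousWithinAt (s := S) (x := p)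
      rw [ContinuousWithinAt] at this
      simpa [hp0, hk] using this
    refine squeeze_zero_norm' ?_ hlim
    filter_upwards [self_mem_nhdsWithin] with q hq
    rw [norm_mul, norm_pow, norm_norm]
    exact mul_le_of_le_one_right (by positivity) (hb q hq)
  · exact hn.continuousWithinAt.mul (hc p hp hp0)

theorem abs_nu_le (hS : IsRotationalCMC S N h) {p : Heis n} (hp : p ∈ S) :
    |nuCos N p| ≤ 1 ∧ |nuSin N p| ≤ 1 := by
  by_cases hp0 : p.1 = 0
  · simp [nuCos, nuSin, hp0]
  · have := hS.nu_sq hp hp0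
    constructor
    · exact abs_le_one_iff_mul_self_le_one.2 (by nlinarith [sq_nonneg (nuSin N p)])
    · exact abs_le_one_iff_mul_self_le_one.2 (by nlinarith [sq_nonneg (nuCos N p)])

/-- A continuous function that is locally constant off the axis is constant. -/
theorem eq_of_locallyConst (hS : IsRotationalCMC S N h) (hconn : IsPreconnected S)
    {F : Heis n → ℝ} (hF : ContinuousOn F S)
    (hloc : ∀ p ∈ S, p.1 ≠ 0 → ∀ᶠ q in 𝓝[S] p, F q = F p) {p q : Heis n} (hp : p ∈ S)
    (hq : q ∈ S) : F p = F q :=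
  hconn.eq_of_locallyConst_off_countable hF (countable_axis hS.invariant hS.hypersurface)
    (fun p hp => hloc p hp.1 fun h0 => hp.2 ⟨hp.1, h0⟩) hp hq

/-- The function `2nht - r sin ψ` has derivative `-(sin² ψ + (2n - 1) cos² ψ) < 0` along the profile
curve, so its extrema on `S` lie on the axis. -/
theorem fst_eq_zero_of_isExtrOn (hn : 1 ≤ n) (hS : IsRotationalCMC S N h) {p : Heis n} (hp : p ∈ S)
    (hext : IsExtrOn (fun q : Heis n => 2 * n * h * q.2 - ‖q.1‖ * nuSin N q) S p) : p.1 = 0 := by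
  by_contra hp0
  obtain ⟨g, hg⟩ := hS.exists_profile hp hp0
  have hr : ‖p.1‖ ≠ 0 := norm_ne_zero_iff.2 hp0
  obtain ⟨hc, hs⟩ := differentiableAt_profCos_profSin hg.contDiffAt hg.pos
  have hΨ : HasFDerivAt (fun x : ℝ × ℝ => 2 * n * h * x.2 - x.1 * profSin g x)
      _ (prof p) := (hasFDerivAt_snd.const_mul (2 * n * h)).fun_sub
        (hasFDerivAt_fst.fun_mul hs.hasFDerivAt)
  have h0 := hg.fderiv_eq_zero_of_isExtrOn hp
    (F := fun q : Heis n => 2 * n * h * q.2 - ‖q.1‖ * nuSin N q)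
    (hg.eventually_nu_eq.mono fun q hq => by simp only [hq.2, prof]) hΨ.differentiableAt hext
  rw [hΨ.fderiv] at h0
  have h1 := (hS.angle_deriv hp hg).1
  have h2 := profCos_sq_add_profSin_sq hg.pos
  simp at h0
  rw [h1] at h0
  set c := profCos g (prof p)
  set s := profSin g (prof p)
  have hpr : (prof p).1 = ‖p.1‖ := rfl
  rw [hpr] at h0
  field_simp at h0
  have hn' : (1 : ℝ) ≤ n := by exact_mod_cast hn
  nlinarith [sq_nonneg c, sq_nonneg s, mul_nonneg (sub_nonneg.2 hn') (sq_nonneg c)]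

/-- The first integral `r^(2n-1) cos ψ + h r^(2n)` of the profile curve is constant on `S`. -/
theorem firstIntegral_eq (hn : 1 ≤ n) (hS : IsRotationalCMC S N h) (hconn : IsPreconnected S)
    {p q : Heis n} (hp : p ∈ S) (hq : q ∈ S) :
    ‖p.1‖ ^ (2 * n - 1) * nuCos N p + h * ‖p.1‖ ^ (2 * n)
      = ‖q.1‖ ^ (2 * n - 1) * nuCos N q + h * ‖q.1‖ ^ (2 * n) := by
  refine hS.eq_of_locallyConst hconn
    (F := fun p : Heis n => ‖p.1‖ ^ (2 * n - 1) * nuCos N p + h * ‖p.1‖ ^ (2 * n)) ?_ ?_ hp hq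
  · refine (continuousOn_norm_pow_mul (fun q hq => (hS.abs_nu_le hq).1)
      (fun p hp hp0 => (hS.continuousWithinAt_nu hp hp0).1) (by omega)).add ?_
    fun_prop
  · intro p hp hp0
    obtain ⟨g, hg⟩ := hS.exists_profile hp hp0
    refine hg.eventually_eq hp (F := fun p : Heis n =>
        ‖p.1‖ ^ (2 * n - 1) * nuCos N p + h * ‖p.1‖ ^ (2 * n))
      (Ψ := fun x => x.1 ^ (2 * n - 1) * profCos g x + h * x.1 ^ (2 * n)) ?_ ?_ ?_
    · exact hg.eventually_nu_eq.mono fun q hq => by simp only [hq.1, prof]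
    · filter_upwards [hg.eventually, self_mem_nhdsWithin] with q hgq hqS
      obtain ⟨hc, hs⟩ := differentiableAt_profCos_profSin hgq.contDiffAt hgq.pos
      have hr : ‖q.1‖ ≠ 0 := norm_ne_zero_iff.2 hgq.ne_zero
      have hΨ : HasFDerivAt (fun x : ℝ × ℝ => x.1 ^ (2 * n - 1) * profCos g x + h * x.1 ^ (2 * n))
          _ (prof q) := (((hasDerivAt_pow (2 * n - 1) _).comp_hasFDerivAt (prof q)
            hasFDerivAt_fst).fun_mul hc.hasFDerivAt).fun_add
              (((hasDerivAt_pow (2 * n) _).comp_hasFDerivAt (prof q) hasFDerivAt_fst).const_mul h)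
      rw [hΨ.fderiv]
      have h2 := (hS.angle_deriv hqS hgq).2
      have hpr : (prof q).1 = ‖q.1‖ := rfl
      obtain ⟨m, rfl⟩ : ∃ m, n = m + 1 := ⟨n - 1, by omega⟩
      have e1 : 2 * (m + 1) - 1 = 2 * m + 1 := by omega
      simp [h2, hpr, e1]
      field_simp
      ring
    · filter_upwards [hg.eventually_pos] with x hx
      obtain ⟨hc, hs⟩ := differentiableAt_profCos_profSin hx.2.1 hx.2.2
      fun_prop

end IsRotationalCMC

/-- A formula for `sin ψ` on the hypersurfaces with `cos ψ = -h r`, which makes sense and is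
continuous on the axis as well: the vertical component of the normal is `-s / √(r² + s²)` with
`s = sin ψ`, and `s² = 1 - h² r²`. -/
def sinExt (N : Heis n → Heis n) (h : ℝ) (q : Heis n) : ℝ :=
  -(theta q (N q) * √(1 + (1 - h ^ 2) * ‖q.1‖ ^ 2))

namespace IsRotationalCMC

variable {S : Set (Heis n)} {N : Heis n → Heis n} {h : ℝ}

theorem nuSin_eq_sinExt (hS : IsRotationalCMC S N h) {p : Heis n} (hp : p ∈ S) (hp0 : p.1 ≠ 0)
    (hcos : nuCos N p = -(h * ‖p.1‖)) : nuSin N p = sinExt N h p := by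
  obtain ⟨g, hg⟩ := hS.exists_profile hp hp0
  have hr : 0 < ‖p.1‖ := norm_pos_iff.2 hp0
  rw [(hg.nu_eq hp).1, profCos] at hcos
  rw [(hg.nu_eq hp).2, profSin, sinExt, hg.normal.self_of_nhdsWithin hp, theta_smul, grad,
    theta_ofFrame, ← grad, metric_grad_grad g hp0]
  have hpr : (prof p).1 = ‖p.1‖ := rfl
  rw [hpr] at hcos ⊢
  have hW2 := Real.sq_sqrt hg.pos.le
  have hWp := Real.sqrt_pos.2 hg.pos
  set W := √(dr g (prof p) ^ 2 + ‖p.1‖ ^ 2 * dt g (prof p) ^ 2)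
  rw [← hW2]
  set A := dr g (prof p)
  set B := dt g (prof p)
  rw [div_eq_iff hWp.ne'] at hcos
  have hpos : 0 < W ^ 2 + B ^ 2 := by positivity
  have hsq : ‖p.1‖ ^ 2 * (W ^ 2 + B ^ 2) = W ^ 2 * (1 + (1 - h ^ 2) * ‖p.1‖ ^ 2) := by
    rw [hcos] at hW2
    linear_combination -hW2
  have h3 : ‖p.1‖ * √(W ^ 2 + B ^ 2) = W * √(1 + (1 - h ^ 2) * ‖p.1‖ ^ 2) := by
    have := congrArg Real.sqrt hsq
    rwa [Real.sqrt_mul (sq_nonneg _), Real.sqrt_mul (sq_nonneg _), Real.sqrt_sq hr.le,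
      Real.sqrt_sq hWp.le] at this
  have hV := Real.sqrt_pos.2 hpos
  generalize √(1 + (1 - h ^ 2) * ‖p.1‖ ^ 2) = R at h3 ⊢
  field_simp
  linear_combination -B * h3

theorem sinExt_sq (hS : IsRotationalCMC S N h)
    (hcos : ∀ p ∈ S, p.1 ≠ 0 → nuCos N p = -(h * ‖p.1‖)) {p : Heis n} (hp : p ∈ S) :
    sinExt N h p ^ 2 = 1 - h ^ 2 * ‖p.1‖ ^ 2 := by
  by_cases hp0 : p.1 = 0
  · have := theta_normal_axis hS.invariant hS.hypersurface hp hp0 hS.unitNormal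
    simp [sinExt, hp0, this]
  · rw [← hS.nuSin_eq_sinExt hp hp0 (hcos p hp hp0)]
    have := hS.nu_sq hp hp0
    rw [hcos p hp hp0] at this
    linarith

theorem continuousOn_sinExt (hS : IsRotationalCMC S N h) : ContinuousOn (sinExt N h) S := by
  have h1 : ContinuousOn (fun q => theta q (N q)) S := by
    simp only [theta_eq]
    have hN := hS.unitNormal.1
    have hI : ContinuousOn (fun q : Heis n => Complex.I • q.1) S := by fun_prop
    exact hN.snd.add (hI.inner hN.fst)
  exact (h1.mul (by fun_prop)).neg

/-- On a hypersurface with `cos ψ = -h r` the vertical position of the sphere arc through a point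
does not depend on the point. -/
theorem arc_position_eq (hS : IsRotationalCMC S N h) (hconn : IsPreconnected S)
    (hh : h ≠ 0) (hcos : ∀ p ∈ S, p.1 ≠ 0 → nuCos N p = -(h * ‖p.1‖)) {p q : Heis n} (hp : p ∈ S)
    (hq : q ∈ S) :
    p.2 - (Real.arcsin (sinExt N h p) + sinExt N h p * (|h| * ‖p.1‖)) / (2 * h * |h|)
      = q.2 - (Real.arcsin (sinExt N h q) + sinExt N h q * (|h| * ‖q.1‖)) / (2 * h * |h|) := by
  refine hS.eq_of_locallyConst hconn (F := fun p : Heis n =>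
    p.2 - (Real.arcsin (sinExt N h p) + sinExt N h p * (|h| * ‖p.1‖)) / (2 * h * |h|)) ?_ ?_ hp hq
  · have hs := hS.continuousOn_sinExt
    have ha := Real.continuous_arcsin.comp_continuousOn hs
    exact continuousOn_snd.sub ((ha.add (hs.mul (by fun_prop))).div_const _)
  · intro p hp hp0
    obtain ⟨g, hg⟩ := hS.exists_profile hp hp0
    have habs : |h| ≠ 0 := abs_ne_zero.2 hh
    -- off the axis `|cos ψ| = |h| r > 0`, so that `arcsin` is differentiable at `sin ψ`
    have hval : ∀ q ∈ S, IsNormalProfile S N g q → profCos g (prof q) = -(h * ‖q.1‖) ∧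
        profSin g (prof q) = sinExt N h q ∧ profSin g (prof q) ^ 2 = 1 - (h * ‖q.1‖) ^ 2 ∧
        profSin g (prof q) ^ 2 < 1 := by
      intro q hq hgq
      have h1 := hcos q hq hgq.ne_zero
      have h2 := hS.nuSin_eq_sinExt hq hgq.ne_zero h1
      rw [(hgq.nu_eq hq).1] at h1
      rw [(hgq.nu_eq hq).2] at h2
      have h3 := profCos_sq_add_profSin_sq hgq.pos
      have h4 : 0 < (h * ‖q.1‖) ^ 2 := by
        have := norm_ne_zero_iff.2 hgq.ne_zero
        positivity
      rw [h1] at h3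
      exact ⟨h1, h2, by linarith, by linarith⟩
    refine hg.eventually_eq hp (F := fun p : Heis n =>
      p.2 - (Real.arcsin (sinExt N h p) + sinExt N h p * (|h| * ‖p.1‖)) / (2 * h * |h|))
      (Ψ := fun x => x.2 - (Real.arcsin (profSin g x) + profSin g x * (|h| * x.1)) / (2 * h * |h|))
      ?_ ?_ ?_
    · filter_upwards [hg.eventually, self_mem_nhdsWithin] with q hgq hqS
      rw [(hval q hqS hgq).2.1]
      rfl
    · filter_upwards [hg.eventually, self_mem_nhdsWithin] with q hgq hqS
      obtain ⟨hc, hs⟩ := differentiableAt_profCos_profSin hgq.contDiffAt hgq.pos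
      obtain ⟨h1, -, h3, h4⟩ := hval q hqS hgq
      have hr : 0 < ‖q.1‖ := norm_pos_iff.2 hgq.ne_zero
      have h5 : |profSin g (prof q)| < 1 := (sq_lt_one_iff_abs_lt_one _).1 h4
      have hΨ : HasFDerivAt (fun x : ℝ × ℝ =>
          x.2 - (Real.arcsin (profSin g x) + profSin g x * (|h| * x.1)) * (2 * h * |h|)⁻¹)
          _ (prof q) := hasFDerivAt_snd.fun_sub
        ((((Real.hasDerivAt_arcsin (abs_lt.1 h5).1.ne' (abs_lt.1 h5).2.ne).comp_hasFDerivAt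
          (prof q) hs.hasFDerivAt).fun_add (hs.hasFDerivAt.fun_mul
            (hasFDerivAt_fst.const_mul |h|))).mul_const (2 * h * |h|)⁻¹)
      simp only [div_eq_mul_inv]
      rw [hΨ.fderiv]
      have h6 := (hS.angle_deriv hqS hgq).1
      have hpr : (prof q).1 = ‖q.1‖ := rfl
      have hsq : √(1 - profSin g (prof q) ^ 2) = |h| * ‖q.1‖ := by
        rw [h3, sub_sub_cancel, Real.sqrt_sq_eq_abs, abs_mul, abs_of_pos hr]
      rw [h1] at h6 ⊢
      rw [mul_neg] at h6 ⊢
      simp [h6, hpr, hsq]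
      have h7 : |h| ^ 2 = h ^ 2 := sq_abs h
      field_simp
      rw [h3, h7]
      ring
    · have hps : 0 < 1 - profSin g (prof p) ^ 2 := by linarith [(hval p hp hg).2.2.2]
      have hcont : ContinuousAt (fun x => 1 - profSin g x ^ 2) (prof p) :=
        continuousAt_const.sub
          ((differentiableAt_profCos_profSin hg.contDiffAt hg.pos).2.continuousAt.pow 2)
      filter_upwards [hg.eventually_pos, hcont.eventually_const_lt hps] with x hx hx2
      obtain ⟨hc, hs⟩ := differentiableAt_profCos_profSin hx.2.1 hx.2.2
      have h5 : |profSin g x| < 1 := (sq_lt_one_iff_abs_lt_one _).1 (by linarith)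
      have ha : DifferentiableAt ℝ (fun x => Real.arcsin (profSin g x)) x :=
        (Real.differentiableAt_arcsin.2 ⟨(abs_lt.1 h5).1.ne', (abs_lt.1 h5).2.ne⟩).comp x hs
      fun_prop

/-- Compact connected rotationally invariant hypersurfaces of constant mean curvature are
spheres. -/
theorem eq_sphere (hn : 1 ≤ n) (hS : IsRotationalCMC S N h) (hcomp : IsCompact S)
    (hconn : IsConnected S) :
    h ≠ 0 ∧ ∃ t₀ : ℝ, S = hmul ((0, t₀) : Heis n) '' sphere n |h| := by
  let M : Heis n → ℝ := fun q => 2 * n * h * q.2 - ‖q.1‖ * nuSin N q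
  have hMc : ContinuousOn M S := by
    have h1 := continuousOn_norm_pow_mul (fun q hq => (hS.abs_nu_le hq).2)
      (fun p hp hp0 => (hS.continuousWithinAt_nu hp hp0).2) one_ne_zero
    simp only [pow_one] at h1
    exact ContinuousOn.sub (by fun_prop) h1
  obtain ⟨p₁, hp₁, hmin⟩ := hcomp.exists_isMinOn hconn.nonempty hMc
  obtain ⟨p₂, hp₂, hmax⟩ := hcomp.exists_isMaxOn hconn.nonempty hMc
  have hz₁ : p₁.1 = 0 := hS.fst_eq_zero_of_isExtrOn hn hp₁ (Or.inl hmin)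
  have hz₂ : p₂.1 = 0 := hS.fst_eq_zero_of_isExtrOn hn hp₂ (Or.inr hmax)
  have hMne : 2 * n * h * p₁.2 ≠ 2 * n * h * p₂.2 := by
    intro heq
    obtain ⟨p, hp, hp0⟩ := exists_off_axis hn hS.invariant hS.hypersurface hconn.nonempty
    have e : M p₁ = M p₂ := by simp [M, hz₁, hz₂, heq]
    refine hp0 (hS.fst_eq_zero_of_isExtrOn hn hp (Or.inr fun q hq => ?_))
    have h1 : M q ≤ M p₂ := hmax hq
    have h2 : M p₁ ≤ M p := hmin hp
    exact (h1.trans_eq e.symm).trans h2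
  have hh : h ≠ 0 := by
    rintro rfl
    simp at hMne
  have hp12 : p₁.2 ≠ p₂.2 := fun heq => hMne (by rw [heq])
  have hcos : ∀ p ∈ S, p.1 ≠ 0 → nuCos N p = -(h * ‖p.1‖) := by
    intro p hp hp0
    have hr : ‖p.1‖ ≠ 0 := norm_ne_zero_iff.2 hp0
    have e := hS.firstIntegral_eq hn hconn.isPreconnected hp hp₁
    obtain ⟨m, rfl⟩ : ∃ m, n = m + 1 := ⟨n - 1, by omega⟩
    have e1 : 2 * (m + 1) - 1 = 2 * m + 1 := by omega
    have e2 : 2 * (m + 1) = 2 * m + 1 + 1 := by omega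
    rw [hz₁, e1, e2] at e
    simp only [norm_zero] at e
    rw [zero_pow (by omega), zero_pow (by omega), zero_mul, mul_zero, add_zero,
      pow_succ _ (2 * m + 1)] at e
    have e3 : ‖p.1‖ ^ (2 * m + 1) * (nuCos N p + h * ‖p.1‖) = 0 := by linear_combination e
    linarith [(mul_eq_zero.1 e3).resolve_left (pow_ne_zero _ hr)]
  have hH : 0 < |h| := abs_pos.2 hh
  let t₀ : ℝ := p₁.2
    - (Real.arcsin (sinExt N h p₁) + sinExt N h p₁ * (|h| * ‖p₁.1‖)) / (2 * h * |h|)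
  have hsub : S ⊆ hmul ((0, t₀) : Heis n) '' sphere n |h| := by
    intro p hp
    rw [mem_translate_sphere hH]
    have hK : p.2 - (Real.arcsin (sinExt N h p) + sinExt N h p * (|h| * ‖p.1‖)) / (2 * h * |h|)
        = t₀ := hS.arc_position_eq hconn.isPreconnected hh hcos hp hp₁
    have hs2 := hS.sinExt_sq hcos hp
    set s := sinExt N h p
    have hs1 : s ^ 2 ≤ 1 := by
      rw [hs2]
      linarith [mul_nonneg (sq_nonneg h) (sq_nonneg ‖p.1‖)]
    have hs3 : |s| ≤ 1 := (sq_le_one_iff_abs_le_one _).1 hs1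
    have hcs : Real.cos (Real.arcsin s) = |h| * ‖p.1‖ := by
      rw [Real.cos_arcsin, hs2, sub_sub_cancel, ← mul_pow, Real.sqrt_sq_eq_abs, abs_mul, abs_norm]
    have hss : Real.sin (Real.arcsin s) = s := Real.sin_arcsin (abs_le.1 hs3).1 (abs_le.1 hs3).2
    have ha := Real.arcsin_mem_Icc s
    have hpt : p.2 - t₀ = (Real.arcsin s + s * (|h| * ‖p.1‖)) / (2 * h * |h|) := by
      rw [← hK]
      ring
    rcases hh.lt_or_gt with hneg | hpos
    · refine ⟨-Real.arcsin s, ⟨by linarith [ha.2], by linarith [ha.1]⟩, ?_, ?_⟩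
      · rw [Real.cos_neg, hcs]
      · rw [hpt, arcHeight, Real.sin_neg, Real.cos_neg, hcs, hss, abs_of_neg hneg]
        field_simp
        ring
    · refine ⟨Real.arcsin s, ha, hcs.symm, ?_⟩
      rw [hpt, arcHeight, hcs, hss, abs_of_pos hpos]
      field_simp
  refine ⟨hh, t₀, hsub.antisymm ?_⟩
  -- the two points on the axis are the poles
  have hpole : ∀ p ∈ S, p.1 = 0 → 2 * |h| ^ 2 * (p.2 - t₀) = arcHeight (Real.pi / 2) ∨
      2 * |h| ^ 2 * (p.2 - t₀) = arcHeight (-(Real.pi / 2)) := by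
    intro p hp hp0
    obtain ⟨φ, hφ, h1, h2⟩ := (mem_translate_sphere hH t₀ p).1 (hsub hp)
    rw [hp0, norm_zero, mul_zero] at h1
    rcases lt_or_eq_of_le hφ.1 with h3 | h3
    · rcases lt_or_eq_of_le hφ.2 with h4 | h4
      · exact absurd h1.symm (Real.cos_pos_of_mem_Ioo ⟨h3, h4⟩).ne'
      · left
        rw [h2, h4]
    · right
      rw [h2, ← h3]
  have hconn2 : IsPreconnected ((fun q : Heis n => 2 * |h| ^ 2 * (q.2 - t₀)) '' S) :=
    hconn.isPreconnected.image _ (by fun_prop)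
  have hIcc : Set.Icc (arcHeight (-(Real.pi / 2))) (arcHeight (Real.pi / 2)) ⊆
      (fun q : Heis n => 2 * |h| ^ 2 * (q.2 - t₀)) '' S := by
    have hne : 2 * |h| ^ 2 * (p₁.2 - t₀) ≠ 2 * |h| ^ 2 * (p₂.2 - t₀) := by
      intro e
      have h2 : (2 * |h| ^ 2 : ℝ) ≠ 0 := by positivity
      exact hp12 (by linarith [mul_left_cancel₀ h2 e])
    rcases hpole p₁ hp₁ hz₁ with e1 | e1 <;> rcases hpole p₂ hp₂ hz₂ with e2 | e2
    · exact absurd (e1.trans e2.symm) hne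
    · exact hconn2.Icc_subset ⟨p₂, hp₂, e2⟩ ⟨p₁, hp₁, e1⟩
    · exact hconn2.Icc_subset ⟨p₁, hp₁, e1⟩ ⟨p₂, hp₂, e2⟩
    · exact absurd (e1.trans e2.symm) hne
  intro p hp
  obtain ⟨φ, hφ, h1, h2⟩ := (mem_translate_sphere hH t₀ p).1 hp
  obtain ⟨q, hq, hq2⟩ := hIcc
    ⟨strictMono_arcHeight.monotone hφ.1, strictMono_arcHeight.monotone hφ.2⟩
  obtain ⟨φ', hφ', h3, h4⟩ := (mem_translate_sphere hH t₀ q).1 (hsub hq)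
  have e : φ' = φ := strictMono_arcHeight.injective (h4.symm.trans hq2)
  have et : q.2 = p.2 := by
    have h5 : (2 * |h| ^ 2 : ℝ) ≠ 0 := by positivity
    have h6 : 2 * |h| ^ 2 * (q.2 - t₀) = 2 * |h| ^ 2 * (p.2 - t₀) := by rw [h2, ← e, h4]
    linarith [mul_left_cancel₀ h5 h6]
  have er : ‖q.1‖ = ‖p.1‖ := mul_left_cancel₀ hH.ne' (by rw [h1, h3, e])
  have := hS.invariant.mem_of_norm_eq (z := q.1) (t := q.2) er hq
  rwa [et] at this

end IsRotationalCMC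

/-! ### The angle as a function of the height -/

theorem continuous_arcHeight : Continuous arcHeight := by
  unfold arcHeight
  fun_prop

theorem surjective_arcHeight : Function.Surjective arcHeight := by
  have hb : ∀ φ, |Real.sin φ * Real.cos φ| ≤ 1 := fun φ => by
    rw [abs_mul]
    exact mul_le_one₀ (Real.abs_sin_le_one φ) (abs_nonneg _) (Real.abs_cos_le_one φ)
  refine continuous_arcHeight.surjective ?_ ?_
  · refine Filter.tendsto_atTop_mono (f := fun φ : ℝ => φ + (-1)) (fun φ => ?_)
      (Filter.tendsto_atTop_add_const_right _ _ Filter.tendsto_id)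
    rw [arcHeight]
    linarith [(abs_le.1 (hb φ)).1]
  · refine Filter.tendsto_atBot_mono (g := arcHeight) (f := fun φ : ℝ => φ + 1) (fun φ => ?_)
      (Filter.tendsto_atBot_add_const_right _ _ Filter.tendsto_id)
    rw [arcHeight]
    linarith [(abs_le.1 (hb φ)).2]

/-- The inverse of `arcHeight`: the angle as a function of the height. -/
def arcAngle : ℝ ≃o ℝ := (strictMono_arcHeight.orderIsoOfSurjective _ surjective_arcHeight).symm

theorem arcAngle_arcHeight (φ : ℝ) : arcAngle (arcHeight φ) = φ :=
  (strictMono_arcHeight.orderIsoOfSurjective _ surjective_arcHeight).symm_apply_apply φ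

theorem arcHeight_arcAngle (y : ℝ) : arcHeight (arcAngle y) = y :=
  (strictMono_arcHeight.orderIsoOfSurjective _ surjective_arcHeight).apply_symm_apply y

theorem hasDerivAt_arcHeight (φ : ℝ) : HasDerivAt arcHeight (2 * Real.cos φ ^ 2) φ := by
  have h := (hasDerivAt_id φ).add ((Real.hasDerivAt_sin φ).mul (Real.hasDerivAt_cos φ))
  refine h.congr_deriv ?_
  linear_combination -Real.sin_sq_add_cos_sq φ

theorem hasDerivAt_arcAngle {y : ℝ} (hy : Real.cos (arcAngle y) ≠ 0) :
    HasDerivAt arcAngle (2 * Real.cos (arcAngle y) ^ 2)⁻¹ y :=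
  HasDerivAt.of_local_left_inverse arcAngle.continuous.continuousAt (hasDerivAt_arcHeight _)
    (by positivity) (Filter.Eventually.of_forall arcHeight_arcAngle)

theorem contDiffAt_arcAngle {y : ℝ} (hy : Real.cos (arcAngle y) ≠ 0) {k : WithTop ℕ∞} :
    ContDiffAt ℝ k arcAngle y := by
  have hc : ContDiff ℝ k arcHeight := contDiff_id.add (Real.contDiff_sin.mul Real.contDiff_cos)
  exact (arcAngle.symm.toHomeomorph.toOpenPartialHomeomorph).contDiffAt_symm_deriv
    (f₀' := 2 * Real.cos (arcAngle y) ^ 2) (by positivity) (Set.mem_univ _)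
    (hasDerivAt_arcHeight (arcAngle y)) hc.contDiffAt

/-! ### The spheres: topology and smoothness -/

/-- The angle `φ` of the point at height `t` of the profile of the sphere centred at height `t₀`. -/
def sphereAngle (H t₀ t : ℝ) : ℝ := arcAngle (2 * H ^ 2 * (t - t₀))

theorem continuous_sphereAngle (H t₀ : ℝ) : Continuous (sphereAngle H t₀) :=
  arcAngle.continuous.comp (by fun_prop)

theorem hasDerivAt_sphereAngle {H t₀ t : ℝ} (h : Real.cos (sphereAngle H t₀ t) ≠ 0) :
    HasDerivAt (sphereAngle H t₀) (H ^ 2 / Real.cos (sphereAngle H t₀ t) ^ 2) t := by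
  have h1 : HasDerivAt (fun t => 2 * H ^ 2 * (t - t₀)) (2 * H ^ 2 * 1) t :=
    ((hasDerivAt_id t).sub_const t₀).const_mul _
  refine ((hasDerivAt_arcAngle h).comp t h1).congr_deriv ?_
  change (2 * Real.cos (sphereAngle H t₀ t) ^ 2)⁻¹ * (2 * H ^ 2 * 1) = _
  field_simp

theorem mem_translate_sphere_iff {H : ℝ} (hH : 0 < H) (t₀ : ℝ) (p : Heis n) :
    p ∈ hmul ((0, t₀) : Heis n) '' sphere n H ↔
      sphereAngle H t₀ p.2 ∈ Set.Icc (-(Real.pi / 2)) (Real.pi / 2) ∧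
        H * ‖p.1‖ = Real.cos (sphereAngle H t₀ p.2) := by
  rw [mem_translate_sphere hH]
  constructor
  · rintro ⟨φ, h1, h2, h3⟩
    have : sphereAngle H t₀ p.2 = φ := by rw [sphereAngle, h3, arcAngle_arcHeight]
    rw [this]
    exact ⟨h1, h2⟩
  · rintro ⟨h1, h2⟩
    exact ⟨_, h1, h2, (arcHeight_arcAngle _).symm⟩

theorem translate_sphere_eq_image (hn : 1 ≤ n) {H : ℝ} (hH : 0 < H) (t₀ : ℝ) :
    hmul ((0, t₀) : Heis n) '' sphere n H =
      (fun x : ℝ × EuclideanSpace ℂ (Fin n) =>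
        (((Real.cos x.1 / H) • x.2, t₀ + arcHeight x.1 / (2 * H ^ 2)) : Heis n)) ''
        (Set.Icc (-(Real.pi / 2)) (Real.pi / 2) ×ˢ Metric.sphere 0 1) := by
  ext p
  rw [mem_translate_sphere hH]
  constructor
  · rintro ⟨φ, h1, h2, h3⟩
    obtain ⟨ζ, hζ, hp⟩ : ∃ ζ : EuclideanSpace ℂ (Fin n), ‖ζ‖ = 1 ∧ p.1 = ‖p.1‖ • ζ := by
      by_cases hp : p.1 = 0
      · exact ⟨EuclideanSpace.single ⟨0, hn⟩ 1, by simp, by simp [hp]⟩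
      · have hr : ‖p.1‖ ≠ 0 := norm_ne_zero_iff.2 hp
        exact ⟨‖p.1‖⁻¹ • p.1, by simp [norm_smul, hr], by simp [smul_smul, hr]⟩
    refine ⟨(φ, ζ), ⟨h1, by simpa using hζ⟩, ?_⟩
    ext1
    · simp only
      rw [← h2, mul_div_cancel_left₀ _ hH.ne', ← hp]
    · simp only
      rw [← h3]
      field_simp
      ring
  · rintro ⟨⟨φ, ζ⟩, ⟨h1, h2⟩, rfl⟩
    have hζ : ‖ζ‖ = 1 := by simpa using h2
    have hc : 0 ≤ Real.cos φ := Real.cos_nonneg_of_mem_Icc h1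
    refine ⟨φ, h1, ?_, ?_⟩
    · simp only [norm_smul, hζ, norm_div, Real.norm_eq_abs, abs_of_nonneg hc, abs_of_pos hH]
      field_simp
    · simp only
      field_simp
      ring

theorem continuous_spherePoint (H t₀ : ℝ) : Continuous
    (fun x : ℝ × EuclideanSpace ℂ (Fin n) =>
      (((Real.cos x.1 / H) • x.2, t₀ + arcHeight x.1 / (2 * H ^ 2)) : Heis n)) := by
  have := continuous_arcHeight
  fun_prop

theorem isCompact_translate_sphere (hn : 1 ≤ n) {H : ℝ} (hH : 0 < H) (t₀ : ℝ) :
    IsCompact (hmul ((0, t₀) : Heis n) '' sphere n H) := by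
  rw [translate_sphere_eq_image hn hH]
  exact (isCompact_Icc.prod (isCompact_sphere _ _)).image (continuous_spherePoint H t₀)

theorem isConnected_translate_sphere (hn : 1 ≤ n) {H : ℝ} (hH : 0 < H) (t₀ : ℝ) :
    IsConnected (hmul ((0, t₀) : Heis n) '' sphere n H) := by
  rw [translate_sphere_eq_image hn hH]
  have hrank : 1 < Module.rank ℝ (EuclideanSpace ℂ (Fin n)) := by
    rw [← Module.finrank_eq_rank, finrank_real_of_complex, finrank_euclideanSpace,
      Fintype.card_fin]
    exact_mod_cast (by omega : 1 < 2 * n)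
  exact ((isConnected_Icc (by linarith [Real.pi_pos])).prod
    (isConnected_sphere hrank 0 zero_le_one)).image _ (continuous_spherePoint H t₀).continuousOn

theorem isRotationallyInvariant_translate_sphere {H : ℝ} (hH : 0 < H) (t₀ : ℝ) :
    IsRotationallyInvariant (hmul ((0, t₀) : Heis n) '' sphere n H) := by
  have key : ∀ (B : EuclideanSpace ℂ (Fin n) ≃ₗᵢ[ℝ] EuclideanSpace ℂ (Fin n)) (p : Heis n),
      p ∈ hmul ((0, t₀) : Heis n) '' sphere n H →
        ((B p.1, p.2) : Heis n) ∈ hmul ((0, t₀) : Heis n) '' sphere n H := by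
    intro B p hp
    rw [mem_translate_sphere_iff hH] at hp ⊢
    simpa using hp
  intro A _
  ext p
  constructor
  · rintro ⟨q, hq, rfl⟩
    exact key A q hq
  · intro hp
    exact ⟨(A.symm p.1, p.2), key A.symm p hp, by simp⟩

/-- The profile function of a sphere away from the poles. -/
def sphereProfile (H t₀ : ℝ) (x : ℝ × ℝ) : ℝ := Real.cos (sphereAngle H t₀ x.2) - H * x.1

theorem hasFDerivAt_sphereProfile {H t₀ : ℝ} {x : ℝ × ℝ}
    (h : Real.cos (sphereAngle H t₀ x.2) ≠ 0) :
    dr (sphereProfile H t₀) x = -H ∧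
    dt (sphereProfile H t₀) x = -(Real.sin (sphereAngle H t₀ x.2)
      * (H ^ 2 / Real.cos (sphereAngle H t₀ x.2) ^ 2)) := by
  have h0 : HasFDerivAt (fun x : ℝ × ℝ => H * x.1) _ x :=
    (hasFDerivAt_fst (𝕜 := ℝ) (E := ℝ) (F := ℝ) (p := x)).const_mul H
  have h1 : HasFDerivAt (sphereProfile H t₀) _ x :=
    ((hasDerivAt_sphereAngle h).cos.comp_hasFDerivAt x hasFDerivAt_snd).fun_sub h0
  rw [dr, dt, h1.fderiv]
  constructor <;> simp

theorem cos_sphereAngle_pos {H : ℝ} (hH : 0 < H) {t₀ : ℝ} {p : Heis n}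
    (hp : p ∈ hmul ((0, t₀) : Heis n) '' sphere n H) (hp0 : p.1 ≠ 0) :
    0 < Real.cos (sphereAngle H t₀ p.2) := by
  rw [← ((mem_translate_sphere_iff hH t₀ p).1 hp).2]
  have := norm_pos_iff.2 hp0
  positivity

theorem isProfile_sphereProfile {H : ℝ} (hH : 0 < H) {t₀ : ℝ} {p : Heis n}
    (hp : p ∈ hmul ((0, t₀) : Heis n) '' sphere n H) (hp0 : p.1 ≠ 0) :
    IsProfile (hmul ((0, t₀) : Heis n) '' sphere n H) (sphereProfile H t₀) p := by
  have hc := (cos_sphereAngle_pos hH hp hp0).ne'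
  refine ⟨hp0, ?_, ?_, ?_⟩
  · have h1 : ContDiffAt ℝ 2 (sphereAngle H t₀) p.2 :=
      ContDiffAt.comp p.2 (contDiffAt_arcAngle hc) (by fun_prop)
    have h2 : ContDiffAt ℝ 2 (fun x : ℝ × ℝ => sphereAngle H t₀ x.2) (prof p) :=
      ContDiffAt.comp (f := Prod.snd) (prof p) h1 contDiffAt_snd
    exact h2.cos.sub (contDiffAt_const.mul contDiffAt_fst)
  · intro h0
    have h1 := (hasFDerivAt_sphereProfile (H := H) (t₀ := t₀) (x := prof p) hc).1
    rw [dr, h0] at h1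
    simp at h1
    exact hH.ne' h1
  · have hmem := (mem_translate_sphere_iff hH t₀ p).1 hp
    have hlt : ∀ φ ∈ Set.Icc (-(Real.pi / 2)) (Real.pi / 2), Real.cos φ ≠ 0 →
        φ ∈ Set.Ioo (-(Real.pi / 2)) (Real.pi / 2) := by
      intro φ hφ hφ0
      refine ⟨lt_of_le_of_ne hφ.1 ?_, lt_of_le_of_ne hφ.2 ?_⟩
      · rintro rfl
        simp at hφ0
      · rintro rfl
        simp at hφ0
    have hcont : ContinuousAt (fun q : Heis n => sphereAngle H t₀ q.2) p :=
      ((continuous_sphereAngle H t₀).comp continuous_snd).continuousAt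
    filter_upwards [hcont.eventually (isOpen_Ioo.mem_nhds (hlt _ hmem.1 hc))] with q hq
    rw [mem_translate_sphere_iff hH, sphereProfile, sub_eq_zero]
    exact ⟨fun h => h.2.symm, fun h => ⟨Set.Ioo_subset_Icc_self hq, h.symm⟩⟩

/-- The map `z ↦ |z| z` is continuously differentiable, also at the origin. -/
theorem _root_.contDiff_norm_smul_self {E : Type*} [NormedAddCommGroup E] [InnerProductSpace ℝ E] :
    ContDiff ℝ 1 (fun z : E => ‖z‖ • z) := by
  rw [contDiff_one_iff_hasFDerivAt]
  refine ⟨fun z => ‖z‖ • ContinuousLinearMap.id ℝ E + (‖z‖⁻¹ • innerSL ℝ z).smulRight z, ?_, ?_⟩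
  · refine Continuous.add (by fun_prop) (continuous_iff_continuousAt.2 fun z => ?_)
    by_cases hz : z = 0
    · subst hz
      have h0 : ((‖(0 : E)‖⁻¹ • innerSL ℝ (0 : E)).smulRight (0 : E)) = 0 := by simp
      rw [ContinuousAt, h0]
      have hlim : Filter.Tendsto (fun z : E => ‖z‖) (𝓝 0) (𝓝 0) := by
        simpa only [norm_zero] using (continuous_norm (E := E)).tendsto 0
      refine squeeze_zero_norm (a := fun z : E => ‖z‖) (fun z => ?_) hlim
      rw [ContinuousLinearMap.norm_smulRight_apply, norm_smul, innerSL_apply_norm, norm_inv,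
        norm_norm]
      by_cases hz : ‖z‖ = 0
      · simp [hz]
      · rw [inv_mul_cancel₀ hz, one_mul]
    · have hr : ‖z‖ ≠ 0 := norm_ne_zero_iff.2 hz
      have h1 : ContinuousAt (fun z : E => ‖z‖⁻¹ • innerSL ℝ z) z :=
        (continuousAt_id.norm.inv₀ hr).smul (innerSL ℝ).continuous.continuousAt
      have h2 := ((ContinuousLinearMap.smulRightL ℝ E E).continuous.continuousAt.comp h1)
      exact h2.clm_apply continuousAt_id
  · intro z
    by_cases hz : z = 0
    · subst hz
      have h0 : ‖(0 : E)‖ • ContinuousLinearMap.id ℝ E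
          + ((‖(0 : E)‖⁻¹ • innerSL ℝ (0 : E)).smulRight (0 : E)) = 0 := by simp
      beta_reduce
      rw [h0, hasFDerivAt_iff_isLittleO_nhds_zero]
      simp only [zero_add, norm_zero, zero_smul, sub_zero, _root_.zero_apply]
      rw [← Asymptotics.isLittleO_norm_left, ← Asymptotics.isLittleO_norm_right]
      simp only [norm_smul, norm_norm]
      have h1 : (fun z : E => ‖z‖) =o[𝓝 0] fun _ => (1 : ℝ) := by
        rw [Asymptotics.isLittleO_one_iff]
        simpa only [norm_zero] using (continuous_norm (E := E)).tendsto 0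
      have h2 := h1.mul_isBigO (Asymptotics.isBigO_refl (fun z : E => ‖z‖) (𝓝 0))
      simpa using h2
    · have h1 := ((hasStrictFDerivAt_norm_sq z).hasFDerivAt.sqrt (by simpa using hz))
      simp only [Real.sqrt_sq (norm_nonneg _)] at h1
      have h2 := h1.fun_smul (hasFDerivAt_id (𝕜 := ℝ) z)
      refine h2.congr_fderiv ?_
      ext u
      simp
      congr 1
      ring

/-! ### The spheres: the poles and the mean curvature -/

/-- The height of the upper half of the sphere, as a function of `|z|`. -/
def capHeight (H ρ : ℝ) : ℝ :=
  1 / (2 * H ^ 2) * (H * ρ * √(1 - H ^ 2 * ρ ^ 2) + Real.arccos (H * ρ))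

theorem hasDerivAt_capHeight {H ρ : ℝ} (hH : 0 < H) (h : H ^ 2 * ρ ^ 2 < 1) :
    HasDerivAt (capHeight H) (-(H * ρ ^ 2 / √(1 - H ^ 2 * ρ ^ 2))) ρ := by
  have h0 : 0 < 1 - H ^ 2 * ρ ^ 2 := by linarith
  have habs : |H * ρ| < 1 := (sq_lt_one_iff_abs_lt_one _).1 (by rwa [mul_pow])
  have h1 : HasDerivAt (fun ρ => H * ρ) (H * 1) ρ := (hasDerivAt_id ρ).const_mul H
  have h2 : HasDerivAt (fun ρ : ℝ => 1 - H ^ 2 * ρ ^ 2) (-(H ^ 2 * (2 * ρ))) ρ := by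
    simpa using ((hasDerivAt_pow 2 ρ).const_mul (H ^ 2)).const_sub 1
  have h3 := ((h1.mul (h2.sqrt h0.ne')).add
    ((Real.hasDerivAt_arccos (abs_lt.1 habs).1.ne' (abs_lt.1 habs).2.ne).comp ρ h1)).const_mul
      (1 / (2 * H ^ 2))
  refine h3.congr_deriv ?_
  have hs := Real.sqrt_pos.2 h0
  have hs2 := Real.sq_sqrt h0.le
  rw [mul_pow]
  set w := √(1 - H ^ 2 * ρ ^ 2)
  field_simp
  rw [hs2]
  ring

/-- The cap of the sphere has the shape `c - H|z|³/3 + …` at the pole, so it is of class `C²`. -/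
theorem contDiffAt_capHeight_norm {E : Type*} [NormedAddCommGroup E] [InnerProductSpace ℝ E]
    {H : ℝ} (hH : 0 < H) {z : E} (hz : H ^ 2 * ‖z‖ ^ 2 < 1) :
    ContDiffAt ℝ 2 (fun z : E => capHeight H ‖z‖) z := by
  have hd : ∀ z : E, H ^ 2 * ‖z‖ ^ 2 < 1 → HasFDerivAt (fun z : E => capHeight H ‖z‖)
      (innerSL ℝ (-(H / √(1 - H ^ 2 * ‖z‖ ^ 2)) • (‖z‖ • z))) z := by
    intro z hz
    by_cases hz0 : z = 0
    · subst hz0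
      have h1 := hasDerivAt_iff_isLittleO.1 (hasDerivAt_capHeight (ρ := 0) hH (by simp))
      have hlim : Filter.Tendsto (fun z : E => ‖z‖) (𝓝 0) (𝓝 0) := by
        simpa only [norm_zero] using (continuous_norm (E := E)).tendsto 0
      have h2 := h1.comp_tendsto hlim
      have h3 : innerSL ℝ (-(H / √(1 - H ^ 2 * ‖(0 : E)‖ ^ 2)) • (‖(0 : E)‖ • (0 : E))) = 0 := by
        simp
      rw [h3, hasFDerivAt_iff_isLittleO]
      rw [← Asymptotics.isLittleO_norm_right]
      simpa [Function.comp_def] using h2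
    · have hr : ‖z‖ ≠ 0 := norm_ne_zero_iff.2 hz0
      have h1 := (hasStrictFDerivAt_norm_sq z).hasFDerivAt.sqrt (by simpa using hz0)
      simp only [Real.sqrt_sq (norm_nonneg _)] at h1
      refine ((hasDerivAt_capHeight hH hz).comp_hasFDerivAt z h1).congr_fderiv ?_
      ext u
      simp
      field_simp
  have hC : ContDiffAt ℝ 1 (fun z : E =>
      innerSL ℝ (-(H / √(1 - H ^ 2 * ‖z‖ ^ 2)) • (‖z‖ • z))) z := by
    have h0 : 1 - H ^ 2 * ‖z‖ ^ 2 ≠ 0 := by linarith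
    have h1 : ContDiffAt ℝ 1 (fun z : E => √(1 - H ^ 2 * ‖z‖ ^ 2)) z :=
      (contDiffAt_const.sub (contDiffAt_const.mul (contDiff_norm_sq ℝ).contDiffAt)).sqrt h0
    have h2 : √(1 - H ^ 2 * ‖z‖ ^ 2) ≠ 0 := (Real.sqrt_pos.2 (by linarith)).ne'
    exact (innerSL ℝ).contDiff.contDiffAt.comp z
      (((contDiffAt_const.div h1 h2).neg).smul contDiff_norm_smul_self.contDiffAt)
  have hopen : {z : E | H ^ 2 * ‖z‖ ^ 2 < 1} ∈ 𝓝 z :=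
    (isOpen_lt (by fun_prop) continuous_const).mem_nhds hz
  exact (contDiffAt_succ_iff_hasFDerivAt (n := 1)).2 ⟨_, ⟨_, hopen, fun x hx => hd x hx⟩, hC⟩

theorem mem_translate_sphere_iff_capHeight {H : ℝ} (hH : 0 < H) (t₀ : ℝ) (p : Heis n) :
    p ∈ hmul ((0, t₀) : Heis n) '' sphere n H ↔ H * ‖p.1‖ ≤ 1 ∧
      (p.2 - t₀ = capHeight H ‖p.1‖ ∨ p.2 - t₀ = -capHeight H ‖p.1‖) := by
  constructor
  · rintro ⟨q, ⟨h1, h2⟩, rfl⟩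
    rw [le_div_iff₀ hH, mul_comm] at h1
    simpa [hmul, imPair, capHeight] using And.intro h1 h2
  · rintro ⟨h1, h2⟩
    refine ⟨(p.1, p.2 - t₀), ⟨?_, h2⟩, ?_⟩
    · rw [le_div_iff₀ hH, mul_comm]
      exact h1
    · ext1 <;> simp [hmul, imPair]

theorem capHeight_pos {H ρ : ℝ} (hH : 0 < H) (hρ : 0 ≤ ρ) (h : H * ρ < 1) : 0 < capHeight H ρ := by
  have h1 : 0 < Real.arccos (H * ρ) := Real.arccos_pos.2 h
  unfold capHeight
  positivity

theorem IsProfile.exists_chart {S : Set (Heis n)} {g : ℝ × ℝ → ℝ} {p : Heis n}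
    (h : IsProfile S g p) : ∃ U : Set (Heis n), IsOpen U ∧ p ∈ U ∧ ∃ f : Heis n → ℝ,
      ContDiffOn ℝ 2 f U ∧ (∀ q ∈ S ∩ U, fderiv ℝ f q ≠ 0) ∧ S ∩ U = {q ∈ U | f q = 0} := by
  obtain ⟨U, hUp, hU, hpU⟩ := eventually_nhds_iff.1 h.eventually
  refine ⟨U, hU, hpU, fun q => g (prof q), fun q hq => ?_, ?_, ?_⟩
  · exact ((hUp q hq).contDiffAt.comp q (contDiffAt_prof (hUp q hq).ne_zero)).contDiffWithinAt
  · rintro q ⟨-, hq⟩ h0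
    have hgq := hUp q hq
    have h1 : HasFDerivAt (fun q => g (prof q)) _ q :=
      (hgq.contDiffAt.differentiableAt two_ne_zero).hasFDerivAt.comp q
        (hasFDerivAt_prof hgq.ne_zero)
    have h2 := hgq.grad_pos
    rw [h1.fderiv] at h0
    rw [metric_grad] at h2
    exact h2.ne' (DFunLike.congr_fun h0 (grad g q))
  · ext q
    constructor
    · rintro ⟨h1, h2⟩
      exact ⟨h2, (hUp q h2).mem_iff.self_of_nhds.1 h1⟩
    · rintro ⟨h1, h2⟩
      exact ⟨(hUp q h1).mem_iff.self_of_nhds.2 h2, h1⟩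

theorem isC2Hypersurface_translate_sphere {H : ℝ} (hH : 0 < H) (t₀ : ℝ) :
    IsC2Hypersurface (hmul ((0, t₀) : Heis n) '' sphere n H) := by
  intro p hp
  by_cases hp0 : p.1 = 0
  swap
  · exact (isProfile_sphereProfile hH hp hp0).exists_chart
  have hcap0 : 0 < capHeight H ‖p.1‖ := capHeight_pos hH (norm_nonneg _) (by simp [hp0])
  -- `ε` is the sign of the pole
  obtain ⟨ε, hε, hεp⟩ : ∃ ε : ℝ, ε ^ 2 = 1 ∧ ε * (p.2 - t₀) = capHeight H ‖p.1‖ := by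
    rcases ((mem_translate_sphere_iff_capHeight hH t₀ p).1 hp).2 with h | h
    · exact ⟨1, by norm_num, by rw [one_mul, h]⟩
    · exact ⟨-1, by norm_num, by rw [h]; ring⟩
  have hUopen : IsOpen {q : Heis n | H ^ 2 * ‖q.1‖ ^ 2 < 1 ∧ 0 < ε * (q.2 - t₀)} :=
    (isOpen_lt (continuous_const.mul (continuous_fst.norm.pow 2)) continuous_const).inter
      (isOpen_lt continuous_const (continuous_const.mul (continuous_snd.sub continuous_const)))
  have hcd : ∀ q : Heis n, H ^ 2 * ‖q.1‖ ^ 2 < 1 →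
      ContDiffAt ℝ 2 (fun q : Heis n => capHeight H ‖q.1‖) q := fun q hq =>
    ContDiffAt.comp (f := Prod.fst) q (contDiffAt_capHeight_norm hH hq) contDiffAt_fst
  have hcd2 : ∀ q : Heis n, ContDiffAt ℝ 2 (fun q : Heis n => ε * (q.2 - t₀)) q := fun q => by
    fun_prop
  refine ⟨_, hUopen, ⟨by simp [hp0], by rw [hεp]; exact hcap0⟩,
    fun q => ε * (q.2 - t₀) - capHeight H ‖q.1‖, ?_, ?_, ?_⟩
  · exact fun q hq => ((hcd2 q).sub (hcd q hq.1)).contDiffWithinAt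
  · rintro q ⟨-, hq⟩ h0
    -- the derivative in the direction of `T` is `ε`
    have hdiff : DifferentiableAt ℝ (fun q : Heis n => ε * (q.2 - t₀) - capHeight H ‖q.1‖) q :=
      ((hcd2 q).sub (hcd q hq.1)).differentiableAt two_ne_zero
    have h1 := hdiff.hasFDerivAt
    rw [h0] at h1
    have h2 : HasDerivAt (fun t : ℝ => ((q.1, t) : Heis n)) (0, 1) q.2 :=
      (hasDerivAt_const q.2 q.1).prodMk (hasDerivAt_id q.2)
    have h3 := HasFDerivAt.comp_hasDerivAt (x := q.2) h1 h2
    have h4 : HasDerivAt (fun t : ℝ => ε * (t - t₀) - capHeight H ‖q.1‖) (ε * 1) q.2 :=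
      (((hasDerivAt_id q.2).sub_const t₀).const_mul ε).sub_const _
    have h5 := h4.unique h3
    simp at h5
    rw [h5] at hε
    norm_num at hε
  · ext q
    constructor
    · rintro ⟨h1, h2⟩
      refine ⟨h2, ?_⟩
      have h3 := ((mem_translate_sphere_iff_capHeight hH t₀ q).1 h1).2
      have h4 : H * ‖q.1‖ < 1 := by
        have h5 := h2.1
        rw [← mul_pow] at h5
        exact (abs_lt.1 ((sq_lt_one_iff_abs_lt_one _).1 h5)).2
      have h5 := capHeight_pos hH (norm_nonneg q.1) h4
      have h6 := h2.2
      have h7 : (ε - 1) * (ε + 1) = 0 := by linear_combination hε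
      rcases mul_eq_zero.1 h7 with h8 | h8
      · obtain rfl : ε = 1 := by linarith
        rcases h3 with h3 | h3
        · beta_reduce
          rw [h3]
          ring
        · rw [h3] at h6
          linarith
      · obtain rfl : ε = -1 := by linarith
        rcases h3 with h3 | h3
        · rw [h3] at h6
          linarith
        · beta_reduce
          rw [h3]
          ring
    · rintro ⟨h1, h2⟩
      refine ⟨(mem_translate_sphere_iff_capHeight hH t₀ q).2 ⟨?_, ?_⟩, h1⟩
      · have h5 := h1.1
        rw [← mul_pow] at h5
        exact (abs_lt.1 ((sq_lt_one_iff_abs_lt_one _).1 h5)).2.le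
      · have h7 : (ε - 1) * (ε + 1) = 0 := by linear_combination hε
        rcases mul_eq_zero.1 h7 with h8 | h8
        · left
          obtain rfl : ε = 1 := by linarith
          linarith
        · right
          obtain rfl : ε = -1 := by linarith
          linarith

/-- The inner unit normal of the sphere. -/
def sphereNormal (H t₀ : ℝ) (q : Heis n) : Heis n :=
  (√(‖q.1‖ ^ 2 + Real.sin (sphereAngle H t₀ q.2) ^ 2))⁻¹ •
    ofFrame q ((-(H * ‖q.1‖)) • q.1 + Real.sin (sphereAngle H t₀ q.2) • (Complex.I • q.1))
      (-Real.sin (sphereAngle H t₀ q.2))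

theorem sphereNormal_pos {H : ℝ} (hH : 0 < H) {t₀ : ℝ} {p : Heis n}
    (hp : p ∈ hmul ((0, t₀) : Heis n) '' sphere n H) :
    0 < ‖p.1‖ ^ 2 + Real.sin (sphereAngle H t₀ p.2) ^ 2 := by
  have h1 := ((mem_translate_sphere_iff hH t₀ p).1 hp).2
  have h2 := Real.sin_sq_add_cos_sq (sphereAngle H t₀ p.2)
  by_cases hp0 : p.1 = 0
  · rw [hp0, norm_zero, mul_zero] at h1
    rw [← h1] at h2
    nlinarith [sq_nonneg ‖p.1‖]
  · have := norm_pos_iff.2 hp0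
    positivity

theorem continuousOn_sphereNormal {H : ℝ} (hH : 0 < H) (t₀ : ℝ) :
    ContinuousOn (sphereNormal H t₀) (hmul ((0, t₀) : Heis n) '' sphere n H) := by
  have hs : Continuous fun q : Heis n => Real.sin (sphereAngle H t₀ q.2) :=
    Real.continuous_sin.comp ((continuous_sphereAngle H t₀).comp continuous_snd)
  have ha : Continuous fun q : Heis n => (-(H * ‖q.1‖)) • q.1
      + Real.sin (sphereAngle H t₀ q.2) • (Complex.I • q.1) := by fun_prop
  have hI : Continuous fun q : Heis n => Complex.I • q.1 := by fun_prop
  have hf : Continuous fun q : Heis n => ofFrame q ((-(H * ‖q.1‖)) • q.1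
      + Real.sin (sphereAngle H t₀ q.2) • (Complex.I • q.1))
      (-Real.sin (sphereAngle H t₀ q.2)) := by
    simp only [ofFrame_eq, imPair_eq_inner]
    exact ha.prodMk (hs.neg.add (hI.inner ha).neg)
  have hr : Continuous fun q : Heis n => √(‖q.1‖ ^ 2 + Real.sin (sphereAngle H t₀ q.2) ^ 2) := by
    fun_prop
  refine ContinuousOn.smul (ContinuousOn.inv₀ hr.continuousOn fun q hq => ?_) hf.continuousOn
  exact (Real.sqrt_pos.2 (sphereNormal_pos hH hq)).ne'

theorem metric_smul_smul (p u : Heis n) (a : ℝ) :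
    metric p (a • u) (a • u) = a ^ 2 * metric p u u := by
  rw [← inner_frameCoord, ← inner_frameCoord, map_smul, inner_smul_left, inner_smul_right]
  simp
  ring

theorem metric_sphereNormal {H : ℝ} (hH : 0 < H) {t₀ : ℝ} {p : Heis n}
    (hp : p ∈ hmul ((0, t₀) : Heis n) '' sphere n H) :
    metric p (sphereNormal H t₀ p) (sphereNormal H t₀ p) = 1 := by
  have h1 := ((mem_translate_sphere_iff hH t₀ p).1 hp).2
  have h2 := Real.sin_sq_add_cos_sq (sphereAngle H t₀ p.2)
  have h3 := sphereNormal_pos hH hp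
  rw [sphereNormal, metric_smul_smul, metric_eq, ofFrame_fst, theta_ofFrame, inv_pow,
    Real.sq_sqrt h3.le, inv_mul_eq_one₀ h3.ne']
  simp only [inner_add_left, inner_add_right, inner_smul_left, inner_smul_right,
      real_inner_self_eq_norm_sq, inner_I_smul_self, real_inner_comm (Complex.I • p.1) p.1,
      norm_smul, Complex.norm_I, one_mul, conj_trivial]
  rw [← h1] at h2
  linear_combination -‖p.1‖ ^ 2 * h2

theorem sphereNormal_eq_smul_grad {H : ℝ} (hH : 0 < H) {t₀ : ℝ} {p : Heis n}
    (hp : p ∈ hmul ((0, t₀) : Heis n) '' sphere n H) (hp0 : p.1 ≠ 0) :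
    ∃ κ : ℝ, 0 < κ ∧ sphereNormal H t₀ p = κ • grad (sphereProfile H t₀) p := by
  have hc := cos_sphereAngle_pos hH hp hp0
  have h1 := ((mem_translate_sphere_iff hH t₀ p).1 hp).2
  have h3 := sphereNormal_pos hH hp
  have hr := norm_pos_iff.2 hp0
  obtain ⟨hA, hB⟩ := hasFDerivAt_sphereProfile (H := H) (t₀ := t₀) (x := prof p) hc.ne'
  have hpr : (prof p).2 = p.2 := rfl
  rw [hpr, ← h1] at hB
  refine ⟨(√(‖p.1‖ ^ 2 + Real.sin (sphereAngle H t₀ p.2) ^ 2))⁻¹ * ‖p.1‖ ^ 2,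
    mul_pos (inv_pos.2 (Real.sqrt_pos.2 h3)) (by positivity), ?_⟩
  rw [sphereNormal, mul_smul, grad, hA, hB]
  congr 1
  apply ext_frame (p := p)
  · rw [Prod.smul_fst, ofFrame_fst, ofFrame_fst]
    generalize Complex.I • p.1 = w
    match_scalars <;> field_simp
  · rw [theta_smul, theta_ofFrame, theta_ofFrame]
    field_simp

theorem isUnitNormal_sphereNormal {H : ℝ} (hH : 0 < H) (t₀ : ℝ) :
    IsUnitNormal (hmul ((0, t₀) : Heis n) '' sphere n H) (sphereNormal H t₀) := by
  refine ⟨continuousOn_sphereNormal hH t₀, fun p hp => ⟨metric_sphereNormal hH hp, fun u hu => ?_⟩⟩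
  by_cases hp0 : p.1 = 0
  · rw [(axis_point (isRotationallyInvariant_translate_sphere hH t₀)
      (isC2Hypersurface_translate_sphere hH t₀) hp hp0).1] at hu
    have h1 : u.2 = 0 := hu
    have h2 : theta p u = 0 := by simp [theta_eq, hp0, h1]
    rw [metric_eq, h2, sphereNormal, Prod.smul_fst, ofFrame_fst, hp0]
    simp
  · obtain ⟨κ, -, hκ⟩ := sphereNormal_eq_smul_grad hH hp hp0
    rw [(isProfile_sphereProfile hH hp hp0).tangent_eq hp] at hu
    have h1 : metric p (grad (sphereProfile H t₀) p) u = 0 := hu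
    rw [hκ, ← inner_frameCoord, map_smul, inner_smul_left, inner_frameCoord, h1, mul_zero]

theorem horizontalNormal_sphereNormal {H : ℝ} (hH : 0 < H) {t₀ : ℝ} {p : Heis n}
    (hp : p ∈ hmul ((0, t₀) : Heis n) '' sphere n H) (hp0 : p.1 ≠ 0) :
    horizontalNormal (sphereNormal H t₀) p
      = radialField (fun x => -Real.cos (sphereAngle H t₀ x.2))
          (fun x => Real.sin (sphereAngle H t₀ x.2)) p := by
  have hc := cos_sphereAngle_pos hH hp hp0
  have h1 := ((mem_translate_sphere_iff hH t₀ p).1 hp).2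
  have hg := isProfile_sphereProfile hH hp hp0
  have hr := norm_pos_iff.2 hp0
  obtain ⟨κ, hκ0, hκ⟩ := sphereNormal_eq_smul_grad hH hp hp0
  have h2 := metric_sphereNormal hH hp
  have hN : sphereNormal H t₀ p = (√(metric p (grad (sphereProfile H t₀) p)
      (grad (sphereProfile H t₀) p)))⁻¹ • grad (sphereProfile H t₀) p := by
    rw [hκ, metric_smul_smul] at h2
    have h3 : metric p (grad (sphereProfile H t₀) p) (grad (sphereProfile H t₀) p) = (κ⁻¹) ^ 2 := by
      field_simp
      linarith
    rw [h3, Real.sqrt_sq (inv_pos.2 hκ0).le, inv_inv, hκ]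
  rw [horizontalNormal_eq hp0 hg.pos hN]
  obtain ⟨hA, hB⟩ := hasFDerivAt_sphereProfile (H := H) (t₀ := t₀) (x := prof p) hc.ne'
  have hpr : (prof p).2 = p.2 := rfl
  have hpr1 : (prof p).1 = ‖p.1‖ := rfl
  have h4 : Real.sin (sphereAngle H t₀ p.2) ^ 2 = 1 - (H * ‖p.1‖) ^ 2 := by
    rw [h1]
    linarith [Real.sin_sq_add_cos_sq (sphereAngle H t₀ p.2)]
  rw [hpr, ← h1] at hB
  have hW : dr (sphereProfile H t₀) (prof p) ^ 2
      + ‖p.1‖ ^ 2 * dt (sphereProfile H t₀) (prof p) ^ 2 = (‖p.1‖⁻¹) ^ 2 := by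
    rw [hA, hB, neg_sq, neg_sq, mul_pow, h4]
    field_simp
    ring
  rw [radialField, radialField, profCos, profSin, hpr1, hW, Real.sqrt_sq (inv_pos.2 hr).le, hA, hB,
    hpr, ← h1]
  congr 3
  · field_simp
  · field_simp

theorem hasConstantMeanCurvature_translate_sphere {H : ℝ} (hH : 0 < H) (t₀ : ℝ) :
    HasConstantMeanCurvature (hmul ((0, t₀) : Heis n) '' sphere n H) H := by
  refine ⟨sphereNormal H t₀, isUnitNormal_sphereNormal hH t₀, ?_⟩
  rintro p ⟨hp, hsing⟩
  have hp0 : p.1 ≠ 0 := by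
    intro hp0
    refine hsing ⟨hp, ?_⟩
    rw [(axis_point (isRotationallyInvariant_translate_sphere hH t₀)
      (isC2Hypersurface_translate_sphere hH t₀) hp hp0).1, horizontal_eq]
    ext u
    simp [theta_eq, hp0]
  have hc := cos_sphereAngle_pos hH hp hp0
  have h1 := ((mem_translate_sphere_iff hH t₀ p).1 hp).2
  have hr := norm_pos_iff.2 hp0
  have hsnd : HasFDerivAt (fun x : ℝ × ℝ => x.2) (.snd ℝ ℝ ℝ) (prof p) := hasFDerivAt_snd
  have hang : HasFDerivAt (fun x : ℝ × ℝ => sphereAngle H t₀ x.2) _ (prof p) :=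
    (hasDerivAt_sphereAngle (t := (prof p).2) hc.ne').comp_hasFDerivAt (prof p) hsnd
  have hC : HasFDerivAt (fun x : ℝ × ℝ => -Real.cos (sphereAngle H t₀ x.2)) _ (prof p) :=
    hang.cos.fun_neg
  have hD : HasFDerivAt (fun x : ℝ × ℝ => Real.sin (sphereAngle H t₀ x.2)) _ (prof p) := hang.sin
  have hT : tangent (hmul ((0, t₀) : Heis n) '' sphere n H) p
      = {u | metric p (sphereNormal H t₀ p) u = 0} := by
    obtain ⟨κ, hκ0, hκ⟩ := sphereNormal_eq_smul_grad hH hp hp0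
    rw [(isProfile_sphereProfile hH hp hp0).tangent_eq hp, hκ]
    ext u
    rw [Set.mem_ofPred_eq, Set.mem_ofPred_eq, ← inner_frameCoord, ← inner_frameCoord, map_smul,
      inner_smul_left]
    simp [hκ0.ne']
  rw [hasDivAlong_iff hp hp0 hC.differentiableAt hD.differentiableAt
    (Filter.Eventually.of_forall fun x => by
      linarith [Real.sin_sq_add_cos_sq (sphereAngle H t₀ x.2)]) _ (metric_sphereNormal hH hp) hT]
  · rw [hC.fderiv, hD.fderiv]
    have hpr : (prof p).2 = p.2 := rfl
    have h4 : Real.sin (sphereAngle H t₀ p.2) ^ 2 = 1 - (H * ‖p.1‖) ^ 2 := by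
      rw [h1]
      linarith [Real.sin_sq_add_cos_sq (sphereAngle H t₀ p.2)]
    simp [hpr, ← h1]
    field_simp
    rw [h4]
    ring
  · filter_upwards [self_mem_nhdsWithin,
      (continuous_fst.continuousAt.eventually_ne hp0).filter_mono nhdsWithin_le_nhds]
      with q hq hq0 using horizontalNormal_sphereNormal hH hq hq0

end Heis

end

theorem mainTheorem5 (n : ℕ) (hn : 1 ≤ n) :
    (∀ H : ℝ, 0 < H → ∀ t₀ : ℝ,
      IsCompact (Heis.hmul ((0, t₀) : Heis n) '' Heis.sphere n H) ∧
      IsConnected (Heis.hmul ((0, t₀) : Heis n) '' Heis.sphere n H) ∧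
      Heis.IsC2Hypersurface (Heis.hmul ((0, t₀) : Heis n) '' Heis.sphere n H) ∧
      Heis.IsRotationallyInvariant (Heis.hmul ((0, t₀) : Heis n) '' Heis.sphere n H) ∧
      Heis.HasConstantMeanCurvature (Heis.hmul ((0, t₀) : Heis n) '' Heis.sphere n H) H) ∧
    (∀ (S : Set (Heis n)) (h : ℝ),
      IsCompact S → IsConnected S → Heis.IsC2Hypersurface S →
      Heis.IsRotationallyInvariant S → Heis.HasConstantMeanCurvature S h →
      h ≠ 0 ∧ ∃ t₀ : ℝ, S = Heis.hmul ((0, t₀) : Heis n) '' Heis.sphere n |h|) := by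
  refine ⟨fun H hH t₀ => ⟨Heis.isCompact_translate_sphere hn hH t₀,
    Heis.isConnected_translate_sphere hn hH t₀, Heis.isC2Hypersurface_translate_sphere hH t₀,
    Heis.isRotationallyInvariant_translate_sphere hH t₀,
    Heis.hasConstantMeanCurvature_translate_sphere hH t₀⟩, ?_⟩
  rintro S h hcomp hconn hC hrot ⟨N, hN, hd⟩
  exact Heis.IsRotationalCMC.eq_sphere hn ⟨hrot, hC, hN, hd⟩ hcomp hconn
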